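/- Let $m\ge 1$, $X>0$, $y^0,\dots,y^{m-1}\in\mathbb R$ and $a_0,\dots,a_{m-1},b\in C^1[0,X]$. For $\varepsilon>0$ consider the Cauchy problem $$\varepsilon^m y^{(m)}=\varepsilon^{m-1}a_{m-1}(x)y^{(m-1)}+\dots+a_0(x)y+b(x)\quad (0<x\le X),\qquad y^{(k)}(0)=\frac{y^k}{\varepsilon^k}\quad(0\le k<m).$$ Put $a_{ij}(x)=a_{2i-j}(x)$ if $0\le 2i-j<m$, $a_{ij}(x)=-1$ if $2i-j=m$, and $a_{ij}(x)=0$ otherwise, and assume the Routh--Hurwitz condition: $(-1)^k\det\big(a_{ij}(x)\big)_{0\le i,j<k}>0$ for all $1\le k\le m$ and $x\in[0,X]$. *Notation.* Let $\|\cdot\|$ be the norm of $C[0,X]$, and let $\chi=-\max\operatorname{Re}\lambda$ over all $x\in[0,X]$ and all roots $\lambda\in\mathbb C$ of $\lambda^m-a_{m-1}(x)\lambda^{m-1}-\dots-a_0(x)$. Let $\bar y=-b/a_0$. Let $\Pi$ be the solution of $\Pi^{(m)}=a_{m-1}(0)\Pi^{(m-1)}+\dots+a_0(0)\Pi$ with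 $\Pi(0)=y^0-\bar y(0)$ and $\Pi^{(k)}(0)=y^k$ for $1\le k<m$. For $x\in[0,X]$ let $\Phi^1(\cdot;x)$ and $\Phi^m(\cdot;x)$ be the solutions of $\Phi^{(m)}=a_{m-1}(x)\Phi^{(m-1)}+\dots+a_0(x)\Phi$ whose initial values $(\Phi,\Phi',\dots,\Phi^{(m-1)})(0)$ are $(1,0,\dots,0)$ and $(0,\dots,0,1)$, respectively. Let $$f(\xi;\varepsilon)=\varepsilon^{-1}\sum_{j=0}^{m-1}[a_j(\varepsilon\xi)-a_j(0)]\Pi^{(j)}(\xi),$$ with the additional summand $-\bar y'(\varepsilon\xi)$ if $m=1$. For $z=(z^1,\dots,z^m)$, $1\le i\le m$ and $0\le\xi\le X/\varepsilon$ let $$\widehat A_i(\varepsilon)[z](\xi)=-\int_0^\xi\partial_\xi^{i-1}\Phi^1(\xi-\zeta;\varepsilon\xi)\,\bar y'(\varepsilon\zeta)\,d\zeta+\int_0^\xi\partial_\xi^{i-1}\Phi^m(\xi-\zeta;\varepsilon\xi)\Big\{\sum_{j=0}^{m-1}[a_j(\varepsilon\zeta)-a_j(\varepsilon\xi)]z^{j+1}(\zeta)+f(\zeta;\varepsilon)\Big\}d\zeta,$$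 the first integral being present only for $m\ge2$ (here $\partial_\xi^{i-1}$ acts on the first argument of $\Phi^1$, $\Phi^m$). Put $z_0=0$, $z_{n+1}=\widehat A(\varepsilon)[z_n]$, and $$y^1_n(x;\varepsilon)=\bar y(x)+\Pi(x/\varepsilon)+\varepsilon z^1_n(x/\varepsilon),\qquad y^i_n(x;\varepsilon)=\varepsilon^{1-i}\Pi^{(i-1)}(x/\varepsilon)+\varepsilon^{2-i}z^i_n(x/\varepsilon)\quad(2\le i\le m).$$ *Claim.* (1) $\chi>0$, and there are constants $C_\Phi>0$ and $\tilde C$ such that for all $0\le i<m$, $\xi\ge0$, $x\in[0,X]$ $$|\partial_\xi^i\Phi^1(\xi;x)|,\ |\partial_\xi^i\Phi^m(\xi;x)|\le C_\Phi(1+\xi^{m-1})e^{-\chi\xi},\qquad |\Pi^{(i)}(\xi)|\le\tilde C(1+\xi^{m-1})e^{-\chi\xi}.\tag{$*$}$$ (2) For each $\varepsilon>0$ the Cauchy problem has a unique classical solution $y(\cdot;\varepsilon)$ on $[0,X]$. (3) Let $\gamma_0\in(0,1)$, let $C_\Phi>0$ and $\tilde C$ be any constants satisfying $(*)$, and put $$\alpha=\sum_{j=0}^{m-1}\|a_j'\|,\quad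 \beta=\alpha\frac{\chi^{m-1}+m!}{\chi^{m+1}},\quad \gamma=\Big\{\tilde C\alpha\max_{\zeta>0}\big[(\zeta+\zeta^m)e^{-\chi\zeta}\big]+\|\bar y'\|\Big\}\frac{\chi^{m-1}+(m-1)!}{\chi^m},$$ $$\varepsilon_0=\frac{\gamma_0}{C_\Phi\beta}\in(0,+\infty]\quad(\varepsilon_0=+\infty\text{ if }\beta=0),\qquad C_0=\frac{C_\Phi\gamma}{1-\gamma_0}\ge0 .$$ Then for all finite $\varepsilon\in(0,\varepsilon_0]$ and all $n\ge0$ the functions $y^i_n(\cdot;\varepsilon)$ are continuous on $[0,X]$ and $$\|y-y^1_n\|\le C_0\,\varepsilon\Big(\gamma_0\frac{\varepsilon}{\varepsilon_0}\Big)^n,\qquad \|y^{(i-1)}-y^i_n\|\le C_0\,\varepsilon^{2-i}\Big(\gamma_0\frac{\varepsilon}{\varepsilon_0}\Big)^n\quad(2\le i\le m),$$ where $\varepsilon/\varepsilon_0=0$ if $\varepsilon_0=+\infty$, and $0^0=1$. Consequently, for each $1\le i\le m$, $y^i_n\to y^{(i-1)}$ as $n\to\infty$ uniformly in $x\in[0,X]$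 and $\varepsilon\in(0,\varepsilon_0]$, and for each fixed $n$ one has $\|y^{(i-1)}-y^i_n\|=O(\varepsilon^{n+2-i})$ on $(0,\varepsilon_0]$; in particular $\|y-y^1_n\|=O(\varepsilon^{n+1})$. -/

import Mathlib

open Set Filter Topology MeasureTheory intervalIntegral
open scoped ENNReal Matrix

noncomputable section

namespace SingPert

/-! ### Linear equations with constant coefficients -/

/-- Matrix of the first-order system `z₀' = z₁, …, z_{m-2}' = z_{m-1}`,
`z_{m-1}' = c₀ z₀ + ⋯ + c_{m-1} z_{m-1}`. -/
def companion {m : ℕ} (c : Fin m → ℝ) : Matrix (Fin m) (Fin m) ℝ :=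
  Matrix.of fun i j =>
    if (i : ℕ) + 1 = m then c j else if (j : ℕ) = (i : ℕ) + 1 then 1 else 0

/-- The solution `w` of `w^{(m)} = c_{m-1} w^{(m-1)} + ⋯ + c₀ w` with `w^{(k)}(0) = w₀ k` for
`k < m`; see `linSol_initial` and `linSol_ode`. -/
def linSol {m : ℕ} [NeZero m] (c w₀ : Fin m → ℝ) (ξ : ℝ) : ℝ :=
  (NormedSpace.exp (ξ • companion c) *ᵥ w₀) 0

section
attribute [local instance] Matrix.linftyOpNormedRing Matrix.linftyOpNormedAlgebra

theorem hasDerivAt_exp_companion {m : ℕ} (c w₀ : Fin m → ℝ) (ξ : ℝ) (i : Fin m) :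
    HasDerivAt (fun t : ℝ => (NormedSpace.exp (t • companion c) *ᵥ w₀) i)
      ((companion c *ᵥ (NormedSpace.exp (ξ • companion c) *ᵥ w₀)) i) ξ := by
  have h := hasDerivAt_exp_smul_const' (𝕂 := ℝ) (companion c) ξ
  have hL : HasDerivAt (fun t : ℝ => (NormedSpace.exp (t • companion c) *ᵥ w₀))
      ((companion c * NormedSpace.exp (ξ • companion c)) *ᵥ w₀) ξ := by
    let L : Matrix (Fin m) (Fin m) ℝ →ₗ[ℝ] (Fin m → ℝ) :=
      { toFun := fun M => M *ᵥ w₀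
        map_add' := fun M N => Matrix.add_mulVec M N w₀
        map_smul' := fun r M => Matrix.smul_mulVec r M w₀ }
    exact (LinearMap.toContinuousLinearMap L).hasFDerivAt.comp_hasDerivAt ξ h
  rw [Matrix.mulVec_mulVec]
  exact hasDerivAt_pi.1 hL i

end

theorem iteratedDeriv_linSol {m : ℕ} [NeZero m] (c w₀ : Fin m → ℝ) (k : Fin m) :
    iteratedDeriv k (linSol c w₀) =
      fun ξ => (NormedSpace.exp (ξ • companion c) *ᵥ w₀) k := by
  obtain ⟨k, hk⟩ := k
  induction k with
  | zero => funext ξ; simp only [iteratedDeriv_zero]; rfl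
  | succ k ih =>
    simp only at ih ⊢
    rw [iteratedDeriv_succ, ih (by omega)]
    funext ξ
    rw [(hasDerivAt_exp_companion c w₀ ξ ⟨k, by omega⟩).deriv]
    generalize NormedSpace.exp (ξ • companion c) *ᵥ w₀ = v
    have hk' : k + 1 ≠ m := by omega
    have hrow : ∀ j : Fin m, companion c ⟨k, by omega⟩ j
        = if j = (⟨k + 1, hk⟩ : Fin m) then 1 else 0 := by
      intro j
      simp [companion, hk', Fin.ext_iff]
    simp [Matrix.mulVec, dotProduct, hrow]

theorem linSol_initial {m : ℕ} [NeZero m] (c w₀ : Fin m → ℝ) (k : Fin m) :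
    iteratedDeriv k (linSol c w₀) 0 = w₀ k := by
  rw [iteratedDeriv_linSol]; simp

theorem linSol_ode {m : ℕ} [NeZero m] (c w₀ : Fin m → ℝ) (ξ : ℝ) :
    HasDerivAt (iteratedDeriv (m - 1) (linSol c w₀))
      (∑ j : Fin m, c j * iteratedDeriv j (linSol c w₀) ξ) ξ := by
  have hm : 0 < m := Nat.pos_of_ne_zero (NeZero.ne m)
  have h := iteratedDeriv_linSol c w₀ ⟨m - 1, by omega⟩
  simp only at h
  rw [h]
  convert hasDerivAt_exp_companion c w₀ ξ ⟨m - 1, by omega⟩ using 1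
  simp only [iteratedDeriv_linSol]
  have hm1 : m - 1 + 1 = m := by omega
  simp [Matrix.mulVec, dotProduct, companion, hm1]

/-! ### The Routh–Hurwitz condition -/

/-- `c_{2i-j}` for `0 ≤ 2i-j < m`, `-1` for `2i-j = m`, and `0` otherwise. -/
def hurwitzEntry {m : ℕ} (c : Fin m → ℝ) (i j : ℕ) : ℝ :=
  if h : j ≤ 2 * i ∧ 2 * i - j < m then c ⟨2 * i - j, h.2⟩
  else if 2 * i = m + j then -1 else 0

/-- The leading principal minors `Δ₁, …, Δ_m` of `(hurwitzEntry c i j)` satisfy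
`(-1)^k Δ_k > 0`. -/
def RouthHurwitz {m : ℕ} (c : Fin m → ℝ) : Prop :=
  ∀ k : ℕ, 1 ≤ k → k ≤ m →
    0 < (-1 : ℝ) ^ k * (Matrix.of fun i j : Fin k => hurwitzEntry c i j).det

/-- The norm of `C[0,X]`. -/
def supNorm (X : ℝ) (g : ℝ → ℝ) : ℝ := sSup ((fun x => |g x|) '' Icc 0 X)

/-! ### The Cauchy problem -/

/-- The data of the problem
`ε^m y^{(m)} = ε^{m-1} a_{m-1}(x) y^{(m-1)} + ⋯ + a₀(x) y + b(x)` on `(0,X]`,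
`y^{(k)}(0) = y0 k / ε^k` for `0 ≤ k < m`. -/
structure Problem (m : ℕ) where
  X : ℝ
  a : Fin m → ℝ → ℝ
  b : ℝ → ℝ
  y0 : Fin m → ℝ

namespace Problem

variable {m : ℕ} [NeZero m] (P : Problem m)

/-- Classical solution on `[0,X]`: of class `C^{m-1}` on `[0,X]`, `m` times differentiable on
`(0,X]`, where it satisfies the equation. All derivatives at the end points are one-sided. -/
structure IsClassicalSolution (ε : ℝ) (y : ℝ → ℝ) : Prop where
  contDiffOn : ContDiffOn ℝ (m - 1 : ℕ) y (Icc 0 P.X)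
  differentiable : ∀ x ∈ Ioc 0 P.X,
    DifferentiableWithinAt ℝ (iteratedDerivWithin (m - 1) y (Icc 0 P.X)) (Icc 0 P.X) x
  equation : ∀ x ∈ Ioc 0 P.X,
    ε ^ m * iteratedDerivWithin m y (Icc 0 P.X) x =
      ∑ j : Fin m, ε ^ (j : ℕ) * P.a j x * iteratedDerivWithin j y (Icc 0 P.X) x + P.b x
  initial : ∀ k : Fin m, iteratedDerivWithin k y (Icc 0 P.X) 0 = P.y0 k / ε ^ (k : ℕ)

/-- The vector of coefficients `(a₀(x), …, a_{m-1}(x))`. -/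
def coeff (x : ℝ) : Fin m → ℝ := fun j => P.a j x

/-- The polynomial `λ^m - a_{m-1}(x) λ^{m-1} - ⋯ - a₀(x)`. -/
def charPoly (x : ℝ) : Polynomial ℂ :=
  Polynomial.X ^ m - ∑ j : Fin m, Polynomial.C (P.a j x : ℂ) * Polynomial.X ^ (j : ℕ)

/-- `χ = - max_{x ∈ [0,X]} max {Re λ : λ a root of the characteristic polynomial at x}`. -/
def chi : ℝ :=
  -sSup {r : ℝ | ∃ x ∈ Icc 0 P.X, ∃ z : ℂ, (P.charPoly x).IsRoot z ∧ r = z.re}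

/-- The solution `ȳ = -b / a₀` of the degenerate equation. -/
def ybar (x : ℝ) : ℝ := -P.b x / P.a 0 x

/-- `ȳ'` on `[0,X]`. -/
def ybar' : ℝ → ℝ := derivWithin P.ybar (Icc 0 P.X)

/-- The boundary-layer function: the solution of
`Π^{(m)} = a_{m-1}(0) Π^{(m-1)} + ⋯ + a₀(0) Π` with
`Π(0) = y0 0 - ȳ(0)` and `Π^{(k)}(0) = y0 k` for `1 ≤ k < m`. -/
def bdry : ℝ → ℝ :=
  linSol (P.coeff 0) fun k => if k = 0 then P.y0 0 - P.ybar 0 else P.y0 k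

/-- `Φ¹(·;x)`: initial values `(1,0,…,0)`. -/
def Phi1 (x : ℝ) : ℝ → ℝ := linSol (P.coeff x) fun k => if k = 0 then 1 else 0

/-- `Φᵐ(·;x)`: initial values `(0,…,0,1)`. -/
def Phim (x : ℝ) : ℝ → ℝ := linSol (P.coeff x) fun k => if (k : ℕ) + 1 = m then 1 else 0

/-- The inhomogeneity `f(ξ;ε)`. -/
def f (ε ξ : ℝ) : ℝ :=
  if m = 1 then ε⁻¹ * ((P.a 0 (ε * ξ) - P.a 0 0) * P.bdry ξ) - P.ybar' (ε * ξ)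
  else ε⁻¹ * ∑ j : Fin m, (P.a j (ε * ξ) - P.a j 0) * iteratedDeriv j P.bdry ξ

/-- The integral operator `Â(ε)`; the component with index `i : Fin m` is `Â_{i+1}(ε)`. The first
integral is present only for `m ≥ 2`. -/
def opA (ε : ℝ) (z : ℝ → Fin m → ℝ) (ξ : ℝ) (i : Fin m) : ℝ :=
  (if m = 1 then 0
    else -∫ ζ in (0 : ℝ)..ξ, iteratedDeriv i (P.Phi1 (ε * ξ)) (ξ - ζ) * P.ybar' (ε * ζ)) +
  ∫ ζ in (0 : ℝ)..ξ, iteratedDeriv i (P.Phim (ε * ξ)) (ξ - ζ) *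
    (∑ j : Fin m, (P.a j (ε * ζ) - P.a j (ε * ξ)) * z ζ j + P.f ε ζ)

/-- The Banach iterates `φ₀ = 0`, `φ_{n+1} = Â(ε)[φ_n]`. -/
def zIter (ε : ℝ) : ℕ → ℝ → Fin m → ℝ
  | 0 => fun _ _ => 0
  | n + 1 => P.opA ε (zIter ε n)

/-- The approximations: the component with index `i : Fin m` is `y^{i+1}_n(x;ε)`, which
approximates the `i`-th derivative of the solution. -/
def yIter (ε : ℝ) (n : ℕ) (i : Fin m) (x : ℝ) : ℝ :=
  if i = 0 then P.ybar x + P.bdry (x / ε) + ε * P.zIter ε n (x / ε) 0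
  else ε ^ (-(i : ℤ)) * iteratedDeriv i P.bdry (x / ε)
    + ε ^ (1 - (i : ℤ)) * P.zIter ε n (x / ε) i

/-! ### The constants -/

/-- `C_Φ > 0` and `|∂_ξ^i Φ¹(ξ;x)|, |∂_ξ^i Φᵐ(ξ;x)| ≤ C_Φ (1 + ξ^{m-1}) e^{-χ ξ}`. -/
def IsPhiBound (CΦ : ℝ) : Prop :=
  0 < CΦ ∧ ∀ i : Fin m, ∀ ξ : ℝ, 0 ≤ ξ → ∀ x ∈ Icc 0 P.X,
    |iteratedDeriv i (P.Phi1 x) ξ| ≤ CΦ * (1 + ξ ^ (m - 1)) * Real.exp (-P.chi * ξ) ∧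
    |iteratedDeriv i (P.Phim x) ξ| ≤ CΦ * (1 + ξ ^ (m - 1)) * Real.exp (-P.chi * ξ)

/-- `|Π^{(i)}(ξ)| ≤ C̃ (1 + ξ^{m-1}) e^{-χ ξ}`. -/
def IsBdryBound (Ct : ℝ) : Prop :=
  ∀ i : Fin m, ∀ ξ : ℝ, 0 ≤ ξ →
    |iteratedDeriv i P.bdry ξ| ≤ Ct * (1 + ξ ^ (m - 1)) * Real.exp (-P.chi * ξ)

/-- `α = ‖a₀'‖ + ⋯ + ‖a_{m-1}'‖`. -/
def alpha : ℝ := ∑ j : Fin m, supNorm P.X (derivWithin (P.a j) (Icc 0 P.X))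

/-- `β = α (χ^{m-1} + m!) / χ^{m+1}`. -/
def beta : ℝ := P.alpha * (P.chi ^ (m - 1) + (m.factorial : ℝ)) / P.chi ^ (m + 1)

/-- `γ = (C̃ α max_{ζ>0} (ζ + ζ^m) e^{-χ ζ} + ‖ȳ'‖) (χ^{m-1} + (m-1)!) / χ^m`. -/
def gam (Ct : ℝ) : ℝ :=
  (Ct * P.alpha * sSup ((fun ζ : ℝ => (ζ + ζ ^ m) * Real.exp (-P.chi * ζ)) '' Ioi 0)
      + supNorm P.X P.ybar')
    * (P.chi ^ (m - 1) + ((m - 1).factorial : ℝ)) / P.chi ^ m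

/-- `ε₀ = γ₀ / (C_Φ β)`, which is `+∞` for `β = 0`. -/
def eps0 (γ₀ CΦ : ℝ) : ℝ≥0∞ := ENNReal.ofReal γ₀ / ENNReal.ofReal (CΦ * P.beta)

/-- `C₀ = C_Φ γ / (1 - γ₀)`. -/
def C0 (γ₀ CΦ Ct : ℝ) : ℝ := CΦ * P.gam Ct / (1 - γ₀)

/-- The number `γ₀ ε / ε₀`, which is `0` for `ε₀ = +∞`. -/
def rate (γ₀ CΦ ε : ℝ) : ℝ := (ENNReal.ofReal (γ₀ * ε) / P.eps0 γ₀ CΦ).toReal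

end Problem

end SingPert

end

open SingPert

/-! In the fast variable ξ = x/ε the scaled derivatives ε^i y^{(i)}(εξ) solve a companion system
with slowly varying coefficients. Subtract ȳ and Π and divide by ε: the remainder z starts from 0,
the source b cancels because a₀ȳ = -b, and what is left of Π is the small difference between the
coefficients at εξ and at 0. Now fix ξ, freeze the coefficients at the endpoint εξ and apply
Duhamel's formula on [0,ξ]. The result is exactly z = Â(ε)[z] (`remainder_eq_opA`).

Since |a_j(εζ) - a_j(εξ)| ≤ ε(ξ-ζ)‖a_j'‖ and the kernel decays like a polynomial times e^{-χ(ξ-ζ)},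
the integrals are bounded uniformly in ξ: Â is Lipschitz with constant C_Φβε = γ₀ε/ε₀ ≤ γ₀
(`abs_opA_sub_le`), and |Â[0]| ≤ C_Φγ (`abs_opA_zero_le`). A fixed point is already known, namely
the remainder of the true solution, so no fixed-point theorem is needed here: |z| ≤ γ₀ sup|z| + C_Φγ
gives sup|z| ≤ C₀, and each iteration gains a factor C_Φβε (`abs_remainder_sub_zIter_le`). Undoing
the scaling multiplies the error by ε^{1-i}.

The exponential bounds rest on two facts. The Routh–Hurwitz condition puts all characteristic roots
in the open left half plane (`hurwitz_stable`, by induction on the degree through the Routh scheme),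
and compactness turns this into χ > 0. The decay must be uniform in x although roots may collide, so
the characteristic polynomial is factored and one root is integrated at a time
(`norm_le_of_aeval_prod_eq_zero`); no distance between roots enters. Existence and uniqueness of y
are Picard iteration and Grönwall's inequality. -/

noncomputable section

namespace SingPert

/-! ### Sufficiency of the Routh–Hurwitz condition -/

/-- Leading principal minor of order `k` of the infinite matrix `(c_{2i-j})`. -/
def hurwitzMinor (c : ℤ → ℝ) (k : ℕ) : ℝ :=
  (Matrix.of fun i j : Fin k => c (2 * (i : ℕ) - (j : ℕ))).det

/-- One step of the Routh scheme. -/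
def routhStep (c : ℤ → ℝ) (n : ℤ) : ℝ :=
  if Even n then c (n + 1) else c (n + 1) - c 0 / c 1 * c (n + 2)

/-- `c₀ x^m + c₁ x^{m-1} + ⋯ + c_m`. -/
def descPoly (c : ℤ → ℝ) (m : ℕ) : Polynomial ℝ :=
  ∑ k ∈ Finset.range (m + 1), Polynomial.C (c k) * Polynomial.X ^ (m - k)

theorem aeval_descPoly (c : ℤ → ℝ) (m : ℕ) (x : ℂ) :
    Polynomial.aeval x (descPoly c m) = ∑ k ∈ Finset.range (m + 1), (c k : ℂ) * x ^ (m - k) := by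
  simp [descPoly]

theorem routhStep_of_neg (c : ℤ → ℝ) (hneg : ∀ n < 0, c n = 0) (h1 : c 1 ≠ 0) :
    ∀ n < 0, routhStep c n = 0 := by
  intro n hn
  unfold routhStep
  split_ifs with he
  · obtain ⟨r, rfl⟩ := he
    exact hneg _ (by omega)
  · by_cases h : n = -1
    · subst h; simp [h1]
    · rw [Int.not_even_iff_odd] at he
      obtain ⟨r, rfl⟩ := he
      rw [hneg (2 * r + 1 + 1) (by omega), hneg (2 * r + 1 + 2) (by omega)]; simp

/-- One round of elimination: subtracting c₀/c₁ times the preceding column from every second column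
keeps the determinant and clears the first row except for c₀. The complementary block is the Hurwitz
matrix of the reduced sequence. -/
theorem hurwitzMinor_succ (c : ℤ → ℝ) (hneg : ∀ n < 0, c n = 0) (h1 : c 1 ≠ 0) (k : ℕ) :
    hurwitzMinor c (k + 1) = c 0 * hurwitzMinor (routhStep c) k := by
  let B : Matrix (Fin (k + 1)) (Fin (k + 1)) ℝ :=
    Matrix.of fun i j => if j = 0 then c (2 * (i : ℕ))
      else routhStep c (2 * (i : ℕ) - (j : ℕ) - 1)
  have hdet : hurwitzMinor c (k + 1) = B.det := by
    refine Matrix.det_eq_of_forall_col_eq_smul_add_pred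
      (fun j : Fin k => if Even ((j : ℕ) + 1) then c 0 / c 1 else 0) ?_ ?_
    · intro i; simp [B]
    · intro i j
      have e : Even (2 * ((i : ℕ) : ℤ) - (((j : ℕ) + 1 : ℕ) : ℤ) - 1) ↔ ¬ Even ((j : ℕ) + 1) := by
        rw [Int.even_sub_one, Int.even_sub, Int.even_coe_nat]
        simp
      simp only [B, Matrix.of_apply, Fin.succ_ne_zero, if_false, routhStep, Fin.val_succ, e,
        Fin.val_castSucc]
      by_cases hj : Even ((j : ℕ) + 1)
      · simp only [hj, not_true, if_true, if_false]
        push_cast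
        ring_nf
      · simp only [hj, not_false_eq_true, if_true, if_false]
        push_cast
        ring_nf
  rw [hdet, Matrix.det_succ_row_zero, Fin.sum_univ_succ]
  -- The first row samples the reduced sequence at negative indices only. At index -1 it vanishes
  -- because c₀ - (c₀/c₁)c₁ = 0.
  have hz : ∀ j : Fin k, B 0 j.succ = 0 := by
    intro j
    simp only [B, Matrix.of_apply, Fin.succ_ne_zero, if_false, Fin.val_succ]
    exact routhStep_of_neg c hneg h1 _ (by simp; omega)
  simp only [hz, mul_zero, zero_mul, Finset.sum_const_zero, add_zero]
  have hB0 : B 0 0 = c 0 := by simp [B]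
  rw [hB0]
  simp only [Fin.val_zero, pow_zero, one_mul]
  congr 1
  unfold hurwitzMinor
  congr 1
  ext i j
  simp only [B, Matrix.submatrix_apply, Matrix.of_apply, Fin.succAbove_zero, Fin.succ_ne_zero,
    if_false, Fin.val_succ]
  congr 1
  push_cast
  ring

/-- With q the reduced polynomial, q(x) + (-1)^m q(-x) is twice the part of q with even-indexed
coefficients. Multiplied by (c₀/c₁)x/2 it restores what the Routh step subtracted, plus the leading
term c₀x^{m+1}. -/
theorem aeval_descPoly_succ (c : ℤ → ℝ) (m : ℕ) (h1 : c 1 ≠ 0) (hbig : ∀ n > (m + 1 : ℤ), c n = 0)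
    (x : ℂ) :
    Polynomial.aeval x (descPoly c (m + 1)) =
      Polynomial.aeval x (descPoly (routhStep c) m) + ((c 0 / c 1 : ℝ) : ℂ) * x / 2 *
        (Polynomial.aeval x (descPoly (routhStep c) m)
          + (-1) ^ m * Polynomial.aeval (-x) (descPoly (routhStep c) m)) := by
  simp only [aeval_descPoly]
  set r : ℂ := ((c 0 / c 1 : ℝ) : ℂ) with hr
  -- The restored terms. A term of even index k+1 cancels the correction in the odd coefficient k,
  -- so the sum telescopes and only s 0, the leading term, survives.
  let s : ℕ → ℂ := fun k => if Even k then r * c (k + 1) * x ^ (m + 1 - k) else 0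
  have htel : ∑ k ∈ Finset.range (m + 1), (s k - s (k + 1)) = c 0 * x ^ (m + 1) := by
    rw [Finset.sum_range_sub']
    have h0 : s 0 = c 0 * x ^ (m + 1) := by
      have : r * c 1 = c 0 := by
        rw [hr]; norm_cast; field_simp
      simp [s, this]
    have hm : s (m + 1) = 0 := by
      simp only [s]
      rw [hbig _ (by push_cast; omega)]
      simp
    rw [h0, hm, sub_zero]
  rw [Finset.sum_range_succ']
  simp only [Nat.cast_zero, Nat.sub_zero]
  rw [← htel, mul_add, Finset.mul_sum, Finset.mul_sum, Finset.mul_sum, ← Finset.sum_add_distrib,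
    ← Finset.sum_add_distrib, ← Finset.sum_add_distrib]
  refine Finset.sum_congr rfl fun k hk => ?_
  have hk' : k ≤ m := by simpa [Nat.lt_succ_iff] using hk
  have hpow : m + 1 - k = m - k + 1 := by omega
  have hpow2 : m + 1 - (k + 1) = m - k := by omega
  have hsign : (-1 : ℂ) ^ m * (-x) ^ (m - k) = (-1) ^ k * x ^ (m - k) := by
    obtain ⟨d, rfl⟩ := Nat.exists_eq_add_of_le hk'
    rw [Nat.add_sub_cancel_left, neg_pow x, pow_add, mul_assoc, ← mul_assoc ((-1) ^ d), ← pow_add,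
      Even.neg_one_pow ⟨d, rfl⟩, one_mul]
  have hsg : (-1 : ℂ) ^ m * ((routhStep c k : ℂ) * (-x) ^ (m - k))
      = routhStep c k * ((-1) ^ k * x ^ (m - k)) := by rw [← hsign]; ring
  rw [hsg]
  simp only [s, routhStep, hpow, hpow2, Int.even_coe_nat]
  by_cases he : Even k
  · have ho : ¬ Even (k + 1) := by rw [Nat.even_add_one]; simpa using he
    simp only [he, ho, if_true, if_false, he.neg_one_pow]
    push_cast
    ring
  · have ho : Even (k + 1) := by rw [Nat.even_add_one]; exact he
    have hodd : Odd k := Nat.not_even_iff_odd.1 he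
    simp only [he, ho, if_true, if_false, hodd.neg_one_pow]
    rw [hr]
    push_cast
    ring_nf

/-- A real polynomial all of whose zeros lie in the open left half plane satisfies
`|p(-x)| ≤ |p(x)|` in the closed right half plane. -/
theorem norm_aeval_neg_le (p : Polynomial ℝ)
    (hp : ∀ x : ℂ, 0 ≤ x.re → Polynomial.aeval x p ≠ 0) (x : ℂ) (hx : 0 ≤ x.re) :
    ‖Polynomial.aeval (-x) p‖ ≤ ‖Polynomial.aeval x p‖ := by
  have hprod : ∀ w : ℂ, ‖Polynomial.aeval w p‖ =
      ‖(p.map (algebraMap ℝ ℂ)).leadingCoeff‖ *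
        ((p.map (algebraMap ℝ ℂ)).roots.map fun r => ‖w - r‖).prod := by
    intro w
    rw [← Polynomial.eval_map_algebraMap]
    conv_lhs => rw [(IsAlgClosed.splits (p.map (algebraMap ℝ ℂ))).eq_prod_roots]
    rw [Polynomial.eval_mul, Polynomial.eval_C, norm_mul, Polynomial.eval_multiset_prod,
      Multiset.map_map]
    congr 1
    have h2 := map_multiset_prod (normHom : ℂ →*₀ ℝ)
      (Multiset.map ((Polynomial.eval w) ∘ fun x => Polynomial.X - Polynomial.C x)
        (p.map (algebraMap ℝ ℂ)).roots)
    simpa [Multiset.map_map, Function.comp_def] using h2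
  -- Replacing -x by -x̄, the mirror image of x in the imaginary axis, allows a comparison factor by
  -- factor: a point r with Re r < 0 is at least as close to -x̄ as to x.
  have hconj : ‖Polynomial.aeval (-x) p‖ = ‖Polynomial.aeval (-(starRingEnd ℂ) x) p‖ := by
    rw [← map_neg (starRingEnd ℂ), Polynomial.aeval_conj, RCLike.norm_conj]
  rw [hconj, hprod, hprod]
  refine mul_le_mul_of_nonneg_left ?_ (norm_nonneg _)
  refine Multiset.prod_map_le_prod_map₀ _ _ (fun _ _ => norm_nonneg _) fun r hr => ?_
  have hre : r.re < 0 := by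
    by_contra h
    refine hp r (not_lt.1 h) ?_
    have := Polynomial.isRoot_of_mem_roots hr
    rwa [Polynomial.IsRoot, Polynomial.eval_map_algebraMap] at this
  rw [← sq_le_sq₀ (norm_nonneg _) (norm_nonneg _), Complex.sq_norm, Complex.sq_norm,
    Complex.normSq_apply, Complex.normSq_apply]
  simp
  nlinarith

/-- By induction the reduced polynomial q is stable. If p(x) = 0 with Re x ≥ 0 and r = c₀/c₁ > 0,
then |1 + rx/2||q(x)| = |rx/2||q(-x)|. This is impossible, as |q(-x)| ≤ |q(x)| ≠ 0 and |1 + rx/2| >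
|rx/2|. -/
theorem hurwitz_stable (m : ℕ) : ∀ c : ℤ → ℝ, (∀ n < 0, c n = 0) → (∀ n > (m : ℤ), c n = 0) →
    0 < c m → (∀ k, 1 ≤ k → k ≤ m → 0 < hurwitzMinor c k) →
    ∀ x : ℂ, 0 ≤ x.re → Polynomial.aeval x (descPoly c m) ≠ 0 := by
  induction m with
  | zero =>
    intro c _ _ hm _ x _
    simp [aeval_descPoly] at hm ⊢
    exact hm.ne'
  | succ m ih =>
    intro c hneg hbig hm hD x hx
    have h0 : 0 < c 0 := by
      have := hD 1 le_rfl (by omega)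
      simpa [hurwitzMinor] using this
    have h1 : 0 < c 1 := by
      rcases Nat.eq_zero_or_pos m with rfl | hpos
      · simpa using hm
      · have := hD 2 (by omega) (by omega)
        rw [hurwitzMinor, Matrix.det_fin_two] at this
        simp [hneg (-1) (by norm_num)] at this
        exact (pos_iff_pos_of_mul_pos this).1 h0
    have hst : ∀ x : ℂ, 0 ≤ x.re → Polynomial.aeval x (descPoly (routhStep c) m) ≠ 0 := by
      refine ih (routhStep c) (routhStep_of_neg c hneg h1.ne') ?_ ?_ ?_
      · intro n hn
        unfold routhStep
        rw [hbig (n + 1) (by push_cast; omega), hbig (n + 2) (by push_cast; omega)]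
        simp
      · unfold routhStep
        rw [hbig ((m : ℤ) + 2) (by push_cast; omega)]
        push_cast at hm
        simpa using hm
      · intro k hk hkm
        have := hD (k + 1) (by omega) (by omega)
        rw [hurwitzMinor_succ c hneg h1.ne'] at this
        exact (pos_iff_pos_of_mul_pos this).1 h0
    intro hzero
    rw [aeval_descPoly_succ c m h1.ne' (by simpa using hbig)] at hzero
    have hle := norm_aeval_neg_le _ hst x hx
    have hne := hst x hx
    set u := Polynomial.aeval x (descPoly (routhStep c) m)
    set v := Polynomial.aeval (-x) (descPoly (routhStep c) m)
    set r : ℝ := c 0 / c 1 with hr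
    have hr0 : 0 < r := div_pos h0 h1
    have heq : (1 + (r : ℂ) * x / 2) * u = -((r : ℂ) * x / 2 * ((-1) ^ m * v)) := by
      linear_combination hzero
    have hnorm := congrArg norm heq
    rw [norm_neg, norm_mul, norm_mul, norm_mul _ v, norm_pow, norm_neg, norm_one, one_pow,
      one_mul] at hnorm
    have hlt : ‖(r : ℂ) * x / 2‖ < ‖1 + (r : ℂ) * x / 2‖ := by
      rw [← sq_lt_sq₀ (norm_nonneg _) (norm_nonneg _), Complex.sq_norm, Complex.sq_norm,
        Complex.normSq_apply, Complex.normSq_apply]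
      have e1 : ((r : ℂ) * x / 2).re = r * x.re / 2 := by simp
      have e2 : ((r : ℂ) * x / 2).im = r * x.im / 2 := by simp
      rw [Complex.add_re, Complex.add_im, e1, e2]
      simp only [Complex.one_re, Complex.one_im]
      have := mul_nonneg hr0.le hx
      nlinarith
    have hu : 0 < ‖u‖ := norm_pos_iff.2 hne
    have := mul_lt_mul_of_pos_right hlt hu
    have := mul_le_mul_of_nonneg_left hle (norm_nonneg ((r : ℂ) * x / 2))
    linarith

theorem RouthHurwitz.re_neg {m : ℕ} [NeZero m] {c : Fin m → ℝ} (h : RouthHurwitz c) {z : ℂ}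
    (hz : z ^ m = ∑ j : Fin m, (c j : ℂ) * z ^ (j : ℕ)) : z.re < 0 := by
  have hm : 0 < m := Nat.pos_of_ne_zero (NeZero.ne m)
  -- The matrix entries list the coefficients from the lowest degree upward, so `descPoly d m` is
  -- the reversed characteristic polynomial, with zeros 1/z. Inversion preserves the closed right
  -- half plane away from 0, and the first minor excludes z = 0.
  let d : ℤ → ℝ := fun n => if h : 0 ≤ n ∧ n < m then -c ⟨n.toNat, by omega⟩
    else if n = m then 1 else 0
  have hent : ∀ i j : ℕ, hurwitzEntry c i j = -d (2 * i - j) := by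
    intro i j
    unfold hurwitzEntry
    simp only [d]
    by_cases h1 : j ≤ 2 * i ∧ 2 * i - j < m
    · rw [dif_pos h1, dif_pos (by omega), neg_neg]
      congr 2
      omega
    · rw [dif_neg h1, dif_neg (by omega)]
      by_cases h2 : 2 * i = m + j
      · rw [if_pos h2, if_pos (by omega)]
      · rw [if_neg h2, if_neg (by omega), neg_zero]
  have hminor : ∀ k, 1 ≤ k → k ≤ m → 0 < hurwitzMinor d k := by
    intro k h1 h2
    have := h k h1 h2
    have he : (Matrix.of fun i j : Fin k => hurwitzEntry c i j)
        = -(Matrix.of fun i j : Fin k => d (2 * (i : ℕ) - (j : ℕ))) := by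
      ext i j; simp [hent]
    rw [he, Matrix.det_neg, Fintype.card_fin, ← mul_assoc, ← mul_pow] at this
    simpa [hurwitzMinor] using this
  have hst := hurwitz_stable m d
    (fun n hn => by simp only [d]; rw [dif_neg (by omega), if_neg (by omega)])
    (fun n hn => by simp only [d]; rw [dif_neg (by omega), if_neg (by omega)]) (by simp [d]) hminor
  have hd : ∀ j : Fin m, d (j : ℕ) = -c j := by
    intro j; simp [d]
  have hdm : d m = 1 := by simp [d]
  have hz0 : z ≠ 0 := by
    rintro rfl
    rw [zero_pow (NeZero.ne m), Finset.sum_eq_single (0 : Fin m)] at hz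
    · have h0 := hminor 1 le_rfl hm
      have h00 := hd 0
      simp only [hurwitzMinor, Matrix.det_unique] at h0
      simp at h0 h00 hz
      rw [h00, Complex.ofReal_eq_zero.1 hz.symm] at h0
      simp at h0
    · intro b _ hb
      have : (b : ℕ) ≠ 0 := fun h => hb (Fin.ext (by simpa using h))
      simp [this]
    · simp
  by_contra hre
  refine hst z⁻¹ ?_ ?_
  · rw [Complex.inv_re]
    exact div_nonneg (not_lt.1 hre) (Complex.normSq_nonneg _)
  · rw [aeval_descPoly, Finset.sum_range_succ, Finset.sum_range]
    have : ∀ j : Fin m, (d (j : ℕ) : ℂ) * z⁻¹ ^ (m - (j : ℕ))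
        = -(z⁻¹ ^ m * ((c j : ℂ) * z ^ (j : ℕ))) := by
      intro j
      rw [hd, inv_pow, inv_pow, pow_sub₀ z hz0 j.2.le]
      push_cast
      field_simp
    rw [Finset.sum_congr rfl fun j _ => this j, Finset.sum_neg_distrib, ← Finset.mul_sum, ← hz, hdm]
    simp [hz0]

/-! ### Decay of solutions of equations with constant coefficients -/

/-- For a root l the function (T - l)u solves the same equation and is annihilated by the remaining
factors, so induction applies to it; u is then recovered from u' - lu by variation of constants. The
bound depends only on K, χ and the number of roots. -/
theorem norm_le_of_aeval_prod_eq_zero {E : Type*} [NormedAddCommGroup E] [NormedSpace ℂ E]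
    (T : E →L[ℂ] E) {K χ : ℝ} (hK : 0 ≤ K) (s : Multiset ℂ)
    (hs : ∀ l ∈ s, l.re ≤ -χ ∧ ∀ v, ‖T v - l • v‖ ≤ K * ‖v‖) :
    ∀ u : ℝ → E, (∀ t, HasDerivAt u (T (u t)) t) →
      (∀ t, Polynomial.aeval T (s.map fun l => Polynomial.X - Polynomial.C l).prod (u t) = 0) →
      ∀ t, 0 ≤ t →
        ‖u t‖ ≤ ‖u 0‖ * (∑ k ∈ Finset.range s.card, (K * t) ^ k) * Real.exp (-χ * t) := by
  induction s using Multiset.induction with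
  | empty =>
    intro u _ h t _
    have := h t
    simp only [Multiset.map_zero, Multiset.prod_zero, map_one] at this
    have h0 : u t = 0 := this
    simp [h0]
  | cons l s ih =>
    intro u hu h t ht
    obtain ⟨hre, hlK⟩ := hs l (Multiset.mem_cons_self l s)
    have hu1 : ∀ t, HasDerivAt (fun t => T (u t) - l • u t) (T (T (u t) - l • u t)) t := by
      intro t
      rw [map_sub, map_smul]
      exact ((T.restrictScalars ℝ).hasFDerivAt.comp_hasDerivAt t (hu t)).sub ((hu t).const_smul l)
    have hih := ih (fun l' hl' => hs l' (Multiset.mem_cons_of_mem hl'))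
      (fun t => T (u t) - l • u t) hu1 (fun t => by
        have := h t
        rw [Multiset.map_cons, Multiset.prod_cons, mul_comm, map_mul] at this
        simpa [mul_apply_eq_comp, Algebra.algebraMap_eq_smul_one] using this)
    set q : ℝ → ℝ := fun t => ∑ k ∈ Finset.range s.card, (K * t) ^ k with hq
    have hqmono : ∀ a b, 0 ≤ a → a ≤ b → q a ≤ q b := by
      intro a b ha hab
      exact Finset.sum_le_sum fun k _ => by gcongr
    have hq0 : 0 ≤ q t := Finset.sum_nonneg fun k _ => by positivity
    -- The integrating factor is normalised at t: g(t) = u(t), g(0) = e^{lt}u(0), and g' contains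
    -- only (T - l)u. The mean value inequality then replaces an integral.
    let g : ℝ → E := fun r => Complex.exp (l * ((t - r : ℝ) : ℂ)) • u r
    have hg : ∀ r, HasDerivAt g (Complex.exp (l * ((t - r : ℝ) : ℂ)) • (T (u r) - l • u r)) r := by
      intro r
      have h1 : HasDerivAt (fun r : ℝ => Complex.exp (l * ((t - r : ℝ) : ℂ)))
          (Complex.exp (l * ((t - r : ℝ) : ℂ)) * (l * ((-1 : ℝ) : ℂ))) r := by
        have h2 : HasDerivAt (fun r : ℝ => t - r) (-1) r := by
          simpa using (hasDerivAt_id r).const_sub t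
        exact (h2.ofReal_comp.const_mul l).cexp
      have := h1.smul (hu r)
      refine this.congr_deriv ?_
      push_cast
      module
    have hnexp : ∀ r ≤ t, ‖Complex.exp (l * ((t - r : ℝ) : ℂ))‖ ≤ Real.exp (-χ * (t - r)) := by
      intro r hr
      rw [Complex.norm_exp, Complex.re_mul_ofReal]
      have : 0 ≤ t - r := sub_nonneg.2 hr
      gcongr
    have hbd : ∀ r ∈ Ico (0 : ℝ) t, ‖Complex.exp (l * ((t - r : ℝ) : ℂ)) • (T (u r) - l • u r)‖
        ≤ K * ‖u 0‖ * q t * Real.exp (-χ * t) := by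
      intro r hr
      rw [norm_smul]
      calc _ ≤ Real.exp (-χ * (t - r)) * (K * ‖u 0‖ * q t * Real.exp (-χ * r)) := by
            refine mul_le_mul (hnexp r hr.2.le) ?_ (norm_nonneg _) (Real.exp_pos _).le
            refine (hih r hr.1).trans ?_
            refine mul_le_mul_of_nonneg_right ?_ (Real.exp_pos _).le
            refine mul_le_mul (hlK _) (hqmono r t hr.1 hr.2.le) ?_ (by positivity)
            exact Finset.sum_nonneg fun k _ => by have := hr.1; positivity
        _ = K * ‖u 0‖ * q t * (Real.exp (-χ * (t - r)) * Real.exp (-χ * r)) := by ring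
        _ = _ := by rw [← Real.exp_add]; ring_nf
    have hmv := norm_image_sub_le_of_norm_deriv_le_segment' (f := g) (a := 0) (b := t)
      (fun r _ => (hg r).hasDerivWithinAt) hbd t ⟨ht, le_rfl⟩
    have hgt : g t = u t := by simp [g]
    have hg0 : ‖g 0‖ ≤ Real.exp (-χ * t) * ‖u 0‖ := by
      simp only [g, norm_smul]
      have := hnexp 0 ht
      rw [sub_zero] at this ⊢
      gcongr
    have htri : ‖u t‖ ≤ ‖g t - g 0‖ + ‖g 0‖ := by
      rw [← hgt]; simpa using norm_add_le (g t - g 0) (g 0)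
    rw [Multiset.card_cons, geom_sum_succ]
    change ‖u t‖ ≤ ‖u 0‖ * (K * t * q t + 1) * Real.exp (-χ * t)
    rw [sub_zero] at hmv
    linarith

theorem norm_le_of_pow_eq_sum {m : ℕ} [NeZero m] (c : Fin m → ℝ) {z : ℂ}
    (hz : z ^ m = ∑ j : Fin m, (c j : ℂ) * z ^ (j : ℕ)) : ‖z‖ ≤ 1 + ∑ j, |c j| := by
  have hS : 0 ≤ ∑ j, |c j| := Finset.sum_nonneg fun _ _ => abs_nonneg _
  by_contra! hlt
  have h1 : 1 ≤ ‖z‖ := by linarith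
  have hle : ‖z‖ ^ m ≤ (∑ j, |c j|) * ‖z‖ ^ (m - 1) := by
    rw [← norm_pow, hz, Finset.sum_mul]
    refine (norm_sum_le _ _).trans (Finset.sum_le_sum fun j _ => ?_)
    rw [norm_mul, norm_pow, Complex.norm_real, Real.norm_eq_abs]
    have := j.2
    gcongr
    omega
  have hm : m = m - 1 + 1 := by have := NeZero.ne m; omega
  have hpow : ‖z‖ ^ m = ‖z‖ * ‖z‖ ^ (m - 1) := by rw [← pow_succ', ← hm]
  rw [hpow] at hle
  have := le_of_mul_le_mul_right hle (by positivity)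
  linarith

/-- The companion matrix as an operator on `ℂ^m`. -/
def companionOp {m : ℕ} (c : Fin m → ℝ) : (Fin m → ℂ) →L[ℂ] (Fin m → ℂ) :=
  LinearMap.toContinuousLinearMap (Matrix.toLin' ((companion c).map (Complex.ofReal)))

theorem companionOp_apply {m : ℕ} (c : Fin m → ℝ) (v : Fin m → ℂ) (i : Fin m) :
    companionOp c v i = ∑ j, (companion c i j : ℂ) * v j := by
  simp [companionOp, Matrix.mulVec, dotProduct]

theorem companionOp_apply_last {m : ℕ} (c : Fin m → ℝ) (v : Fin m → ℂ) (i : Fin m)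
    (hi : (i : ℕ) + 1 = m) : companionOp c v i = ∑ j, (c j : ℂ) * v j := by
  simp [companionOp_apply, companion, hi]

theorem companionOp_apply_of_lt {m : ℕ} (c : Fin m → ℝ) (v : Fin m → ℂ) (k : ℕ) (hk : k + 1 < m) :
    companionOp c v ⟨k, by omega⟩ = v ⟨k + 1, hk⟩ := by
  have hrow : ∀ j : Fin m, companion c ⟨k, by omega⟩ j
      = if j = (⟨k + 1, hk⟩ : Fin m) then 1 else 0 := by
    intro j
    simp [companion, hk.ne, Fin.ext_iff]
  simp [companionOp_apply, hrow, apply_ite (Complex.ofReal)]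

theorem norm_companionOp_apply_le {m : ℕ} (c : Fin m → ℝ) (v : Fin m → ℂ) :
    ‖companionOp c v‖ ≤ (1 + ∑ j, |c j|) * ‖v‖ := by
  have hS : 0 ≤ ∑ j, |c j| := Finset.sum_nonneg fun _ _ => abs_nonneg _
  refine (pi_norm_le_iff_of_nonneg (by positivity)).2 fun i => ?_
  by_cases hi : (i : ℕ) + 1 = m
  · rw [companionOp_apply_last c v i hi]
    calc _ ≤ ∑ j, |c j| * ‖v‖ := by
          refine (norm_sum_le _ _).trans (Finset.sum_le_sum fun j _ => ?_)
          rw [norm_mul, Complex.norm_real, Real.norm_eq_abs]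
          gcongr
          exact norm_le_pi_norm v j
      _ ≤ _ := by rw [← Finset.sum_mul]; nlinarith [norm_nonneg v]
  · rw [show i = ⟨i, i.2⟩ from rfl, companionOp_apply_of_lt c v i (by omega)]
    have := norm_le_pi_norm v ⟨i + 1, by omega⟩
    nlinarith [norm_nonneg v]

theorem companionOp_pow_apply_zero {m : ℕ} [NeZero m] (c : Fin m → ℝ) (v : Fin m → ℂ) (k : Fin m) :
    (companionOp c ^ (k : ℕ)) v 0 = v k := by
  obtain ⟨k, hk⟩ := k
  induction k generalizing v with
  | zero => simp
  | succ k ih =>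
    simp only at ih ⊢
    rw [pow_succ, mul_apply_eq_comp, ih _ (by omega), companionOp_apply_of_lt]

/-- Coordinate 0 of T^k v is v_k for k < m, and of T^m v it is Σ c_j v_j, so p(T)v has coordinate 0
equal to zero. Coordinate k of p(T)v is coordinate 0 of T^k p(T)v = p(T)T^k v, which vanishes too.
-/
theorem aeval_companionOp_eq_zero {m : ℕ} [NeZero m] (c : Fin m → ℝ) :
    Polynomial.aeval (companionOp c) (Polynomial.X ^ m
      - ∑ j : Fin m, Polynomial.C (c j : ℂ) * Polynomial.X ^ (j : ℕ)) = 0 := by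
  have hm : m - 1 + 1 = m := by have := NeZero.ne m; omega
  set p : Polynomial ℂ := Polynomial.X ^ m
      - ∑ j : Fin m, Polynomial.C (c j : ℂ) * Polynomial.X ^ (j : ℕ) with hp
  have h0 : ∀ v, Polynomial.aeval (companionOp c) p v 0 = 0 := by
    intro v
    have hmv : (companionOp c ^ m) v 0 = ∑ j, (c j : ℂ) * v j := by
      have hpow : companionOp c ^ m = companionOp c ^ (m - 1) * companionOp c := by
        rw [← pow_succ, hm]
      rw [hpow, mul_apply_eq_comp]
      have := companionOp_pow_apply_zero c (companionOp c v) ⟨m - 1, by omega⟩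
      simp only at this
      rw [this, companionOp_apply_last _ _ _ hm]
    rw [hp, map_sub, map_sum]
    simp only [map_pow, map_mul, Polynomial.aeval_X, Polynomial.aeval_C,
      Algebra.algebraMap_eq_smul_one, smul_mul_assoc, one_mul, sub_apply,
      sum_apply, smul_apply, Pi.sub_apply,
      Finset.sum_apply, Pi.smul_apply, companionOp_pow_apply_zero, hmv, smul_eq_mul, sub_self]
  ext v k
  rw [← companionOp_pow_apply_zero c (Polynomial.aeval (companionOp c) p v) k,
    ← mul_apply_eq_comp]
  have : companionOp c ^ (k : ℕ) * Polynomial.aeval (companionOp c) p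
      = Polynomial.aeval (companionOp c) p * companionOp c ^ (k : ℕ) := by
    have := congrArg (Polynomial.aeval (companionOp c)) (mul_comm (Polynomial.X ^ (k : ℕ)) p)
    simpa using this
  rw [this, mul_apply_eq_comp, h0]
  simp

theorem charPoly_monic_natDegree {m : ℕ} [NeZero m] (c : Fin m → ℝ) :
    (Polynomial.X ^ m - ∑ j : Fin m, Polynomial.C (c j : ℂ) * Polynomial.X ^ (j : ℕ)).Monic ∧
    (Polynomial.X ^ m
      - ∑ j : Fin m, Polynomial.C (c j : ℂ) * Polynomial.X ^ (j : ℕ)).natDegree = m := by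
  have hdeg : (∑ j : Fin m, Polynomial.C (c j : ℂ) * Polynomial.X ^ (j : ℕ)).degree
      < ((m : ℕ) : WithBot ℕ) := by
    refine (Polynomial.degree_sum_le _ _).trans_lt ?_
    refine (Finset.sup_lt_iff (WithBot.bot_lt_coe m)).2 fun j _ => ?_
    exact (Polynomial.degree_C_mul_X_pow_le _ _).trans_lt (WithBot.coe_lt_coe.2 j.2)
  have hd2 : (∑ j : Fin m, Polynomial.C (c j : ℂ) * Polynomial.X ^ (j : ℕ)).degree
      < (Polynomial.X ^ m : Polynomial ℂ).degree := by simpa using hdeg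
  refine ⟨(Polynomial.monic_X_pow m).sub_of_left hd2, ?_⟩
  rw [Polynomial.natDegree_eq_of_degree_eq (Polynomial.degree_sub_eq_left_of_degree_lt hd2)]
  simp

/-- Both the operator norm and the roots are bounded by 1 + Σ|c_j|, so ‖T - l‖ ≤ 2(1 + Σ|c_j|), a
quantity bounded uniformly in x. -/
theorem abs_exp_companion_mulVec_le {m : ℕ} [NeZero m] (c w₀ : Fin m → ℝ) {χ : ℝ}
    (hχ : ∀ z : ℂ, z ^ m = ∑ j : Fin m, (c j : ℂ) * z ^ (j : ℕ) → z.re ≤ -χ) (i : Fin m) {ξ : ℝ}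
    (hξ : 0 ≤ ξ) :
    |(NormedSpace.exp (ξ • companion c) *ᵥ w₀) i| ≤
      ‖w₀‖ * (∑ k ∈ Finset.range m, (2 * (1 + ∑ j, |c j|) * ξ) ^ k) * Real.exp (-χ * ξ) := by
  have hS : 0 ≤ ∑ j, |c j| := Finset.sum_nonneg fun _ _ => abs_nonneg _
  set p : Polynomial ℂ := Polynomial.X ^ m
      - ∑ j : Fin m, Polynomial.C (c j : ℂ) * Polynomial.X ^ (j : ℕ) with hp
  obtain ⟨hmonic, hnat⟩ := charPoly_monic_natDegree c
  rw [← hp] at hmonic hnat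
  have hsplit := (IsAlgClosed.splits p)
  have hprod : (p.roots.map fun l => Polynomial.X - Polynomial.C l).prod = p := by
    conv_rhs => rw [hsplit.eq_prod_roots]
    simp [hmonic.leadingCoeff]
  have hcard : p.roots.card = m := by
    rw [← hnat]; exact hsplit.natDegree_eq_card_roots.symm
  let u : ℝ → Fin m → ℂ := fun t i => ((NormedSpace.exp (t • companion c) *ᵥ w₀) i : ℝ)
  have hu : ∀ t, HasDerivAt u (companionOp c (u t)) t := by
    intro t
    rw [hasDerivAt_pi]
    intro i
    have := (hasDerivAt_exp_companion c w₀ t i).ofReal_comp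
    refine this.congr_deriv ?_
    rw [companionOp_apply]
    simp [u, Matrix.mulVec, dotProduct]
  have hu0 : ‖u 0‖ ≤ ‖w₀‖ := by
    refine (pi_norm_le_iff_of_nonneg (norm_nonneg _)).2 fun i => ?_
    simpa [u] using norm_le_pi_norm w₀ i
  have key := norm_le_of_aeval_prod_eq_zero (companionOp c) (K := 2 * (1 + ∑ j, |c j|)) (χ := χ)
    (by positivity) p.roots (fun l hl => by
      have hroot : l ^ m = ∑ j : Fin m, (c j : ℂ) * l ^ (j : ℕ) := by
        have := Polynomial.isRoot_of_mem_roots hl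
        rw [hp] at this
        simpa [Polynomial.eval_finsetSum, sub_eq_zero] using this
      refine ⟨hχ l hroot, fun v => ?_⟩
      have h1 := norm_companionOp_apply_le c v
      have h2 := norm_le_of_pow_eq_sum c hroot
      calc _ ≤ ‖companionOp c v‖ + ‖l • v‖ := norm_sub_le _ _
        _ ≤ _ := by rw [norm_smul]; nlinarith [norm_nonneg v]) u hu
    (fun t => by rw [hprod, hp, aeval_companionOp_eq_zero]; rfl) ξ hξ
  rw [hcard] at key
  have hi : |(NormedSpace.exp (ξ • companion c) *ᵥ w₀) i| ≤ ‖u ξ‖ := by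
    have := norm_le_pi_norm (u ξ) i
    simpa [u] using this
  refine hi.trans (key.trans ?_)
  gcongr

theorem geom_sum_le_one_add_pow {m : ℕ} [NeZero m] {K ξ : ℝ} (hK : 1 ≤ K) (hξ : 0 ≤ ξ) :
    ∑ k ∈ Finset.range m, (K * ξ) ^ k ≤ m * K ^ m * (1 + ξ ^ (m - 1)) := by
  calc _ ≤ ∑ _k ∈ Finset.range m, K ^ m * (1 + ξ ^ (m - 1)) := by
        refine Finset.sum_le_sum fun k hk => ?_
        rw [Finset.mem_range] at hk
        rw [mul_pow]
        refine mul_le_mul (pow_le_pow_right₀ hK hk.le) ?_ (by positivity) (by positivity)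
        rcases le_total ξ 1 with h | h
        · have := pow_le_one₀ hξ h (n := k)
          have : 0 ≤ ξ ^ (m - 1) := by positivity
          linarith
        · have := pow_le_pow_right₀ h (show k ≤ m - 1 by omega)
          linarith
    _ = _ := by rw [Finset.sum_const, Finset.card_range, nsmul_eq_mul]; ring

/-! ### Positivity of χ and the exponential bounds, uniformly in x -/

namespace Problem

variable {m : ℕ} (P : Problem m)

theorem charPoly_isRoot_iff (x : ℝ) (z : ℂ) :
    (P.charPoly x).IsRoot z ↔ z ^ m = ∑ j : Fin m, (P.coeff x j : ℂ) * z ^ (j : ℕ) := by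
  simp [charPoly, coeff, Polynomial.eval_finsetSum, sub_eq_zero]

theorem exists_bound_coeff (ha : ∀ j, ContinuousOn (P.a j) (Icc 0 P.X)) :
    ∃ S : ℝ, ∀ x ∈ Icc 0 P.X, 1 + ∑ j, |P.coeff x j| ≤ S := by
  have hc : ContinuousOn (fun x => 1 + ∑ j, |P.coeff x j|) (Icc 0 P.X) :=
    continuousOn_const.add (continuousOn_finsetSum _ fun j _ => (ha j).abs)
  obtain ⟨S, hS⟩ := isCompact_Icc.bddAbove_image hc
  exact ⟨S, fun x hx => hS (mem_image_of_mem _ hx)⟩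

variable [NeZero m]

/-- The pairs (x, z) with z a root at x form a compact set, so the supremum defining χ is attained
at an actual root, whose real part is negative. -/
theorem chi_pos_and_re_le (hX : 0 < P.X) (ha : ∀ j, ContinuousOn (P.a j) (Icc 0 P.X))
    (hRH : ∀ x ∈ Icc 0 P.X, RouthHurwitz (P.coeff x)) :
    0 < P.chi ∧ ∀ x ∈ Icc 0 P.X, ∀ z : ℂ,
      z ^ m = ∑ j : Fin m, (P.coeff x j : ℂ) * z ^ (j : ℕ) → z.re ≤ -P.chi := by
  obtain ⟨S, hS⟩ := P.exists_bound_coeff ha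
  set R : Set ℝ := {r : ℝ | ∃ x ∈ Icc 0 P.X, ∃ z : ℂ, (P.charPoly x).IsRoot z ∧ r = z.re} with hR
  have hcont : ContinuousOn (fun q : ℝ × ℂ => q.2 ^ m
      - ∑ j : Fin m, (P.coeff q.1 j : ℂ) * q.2 ^ (j : ℕ)) (Icc 0 P.X ×ˢ Metric.closedBall 0 S) := by
    refine ContinuousOn.sub (by fun_prop) (continuousOn_finsetSum _ fun j _ => ?_)
    refine ContinuousOn.mul ?_ (by fun_prop)
    exact Complex.continuous_ofReal.comp_continuousOn
      ((ha j).comp continuousOn_fst fun q hq => hq.1)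
  have hcpt : IsCompact ((Icc 0 P.X ×ˢ Metric.closedBall (0 : ℂ) S) ∩
      (fun q : ℝ × ℂ => q.2 ^ m - ∑ j : Fin m, (P.coeff q.1 j : ℂ) * q.2 ^ (j : ℕ)) ⁻¹' {0}) := by
    have hK : IsCompact (Icc 0 P.X ×ˢ Metric.closedBall (0 : ℂ) S) :=
      isCompact_Icc.prod (isCompact_closedBall 0 S)
    exact hK.of_isClosed_subset
      (hcont.preimage_isClosed_of_isClosed hK.isClosed isClosed_singleton) inter_subset_left
  have hRimg : R = (fun q : ℝ × ℂ => q.2.re) '' ((Icc 0 P.X ×ˢ Metric.closedBall (0 : ℂ) S) ∩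
      (fun q : ℝ × ℂ => q.2 ^ m - ∑ j : Fin m, (P.coeff q.1 j : ℂ) * q.2 ^ (j : ℕ)) ⁻¹' {0}) := by
    ext r
    constructor
    · rintro ⟨x, hx, z, hz, rfl⟩
      rw [charPoly_isRoot_iff] at hz
      refine ⟨(x, z), ⟨⟨hx, ?_⟩, ?_⟩, rfl⟩
      · rw [mem_closedBall_zero_iff]
        exact (norm_le_of_pow_eq_sum _ hz).trans (hS x hx)
      · simp [hz]
    · rintro ⟨⟨x, z⟩, ⟨⟨hx, _⟩, hz⟩, rfl⟩
      refine ⟨x, hx, z, ?_, rfl⟩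
      rw [charPoly_isRoot_iff]
      simpa [sub_eq_zero] using hz
  have hRc : IsCompact R := by
    rw [hRimg]
    exact hcpt.image (by fun_prop)
  have hRne : R.Nonempty := by
    have h0 : (0 : ℝ) ∈ Icc 0 P.X := ⟨le_rfl, hX.le⟩
    obtain ⟨-, hnat⟩ := charPoly_monic_natDegree (P.coeff 0)
    obtain ⟨z, hz⟩ := IsAlgClosed.exists_root (P.charPoly 0) (by
      have : (P.charPoly 0).natDegree ≠ 0 := by
        have h : (P.charPoly 0).natDegree = m := hnat
        rw [h]; exact NeZero.ne m
      exact fun h => this (Polynomial.natDegree_eq_of_degree_eq_some h))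
    exact ⟨z.re, 0, h0, z, hz, rfl⟩
  have hchi : P.chi = -sSup R := rfl
  constructor
  · obtain ⟨x, hx, z, hz, hr⟩ := hRc.sSup_mem hRne
    rw [charPoly_isRoot_iff] at hz
    have := (hRH x hx).re_neg hz
    rw [hchi, hr]
    linarith
  · intro x hx z hz
    rw [hchi, neg_neg]
    exact le_csSup hRc.bddAbove ⟨x, hx, z, (P.charPoly_isRoot_iff x z).2 hz, rfl⟩

theorem exists_linSol_bound (hX : 0 < P.X) (ha : ∀ j, ContinuousOn (P.a j) (Icc 0 P.X))
    (hRH : ∀ x ∈ Icc 0 P.X, RouthHurwitz (P.coeff x)) :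
    ∃ C > 0, ∀ x ∈ Icc 0 P.X, ∀ w₀ : Fin m → ℝ, ∀ i : Fin m, ∀ ξ : ℝ, 0 ≤ ξ →
      |iteratedDeriv i (linSol (P.coeff x) w₀) ξ| ≤
        ‖w₀‖ * C * (1 + ξ ^ (m - 1)) * Real.exp (-P.chi * ξ) := by
  obtain ⟨S, hS⟩ := P.exists_bound_coeff ha
  obtain ⟨_, hre⟩ := P.chi_pos_and_re_le hX ha hRH
  have hm : 0 < m := Nat.pos_of_ne_zero (NeZero.ne m)
  have hS1 : ∀ x, 1 ≤ 1 + ∑ j, |P.coeff x j| := fun x => by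
    have : 0 ≤ ∑ j, |P.coeff x j| := Finset.sum_nonneg fun _ _ => abs_nonneg _
    linarith
  have hS0 : 1 ≤ S := (hS1 0).trans (hS 0 ⟨le_rfl, hX.le⟩)
  refine ⟨m * (2 * S) ^ m, by positivity, fun x hx w₀ i ξ hξ => ?_⟩
  rw [iteratedDeriv_linSol]
  refine (abs_exp_companion_mulVec_le (P.coeff x) w₀ (hre x hx) i hξ).trans ?_
  have h1 := geom_sum_le_one_add_pow (m := m) (K := 2 * (1 + ∑ j, |P.coeff x j|)) (ξ := ξ)
    (by linarith [hS1 x]) hξ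
  have h2 : (2 * (1 + ∑ j, |P.coeff x j|)) ^ m ≤ (2 * S) ^ m :=
    pow_le_pow_left₀ (by linarith [hS1 x]) (by linarith [hS x hx]) m
  refine mul_le_mul_of_nonneg_right ?_ (Real.exp_pos _).le
  rw [mul_assoc ‖w₀‖]
  refine mul_le_mul_of_nonneg_left (h1.trans ?_) (norm_nonneg _)
  gcongr

theorem exists_isPhiBound (hX : 0 < P.X) (ha : ∀ j, ContinuousOn (P.a j) (Icc 0 P.X))
    (hRH : ∀ x ∈ Icc 0 P.X, RouthHurwitz (P.coeff x)) : ∃ CΦ, P.IsPhiBound CΦ := by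
  obtain ⟨C, hC, h⟩ := P.exists_linSol_bound hX ha hRH
  have hone : ∀ (p : Fin m → Prop) [DecidablePred p],
      ‖(fun k => if p k then (1 : ℝ) else 0 : Fin m → ℝ)‖ ≤ 1 := by
    intro p _
    refine (pi_norm_le_iff_of_nonneg zero_le_one).2 fun k => ?_
    split_ifs <;> simp
  refine ⟨C, hC, fun i ξ hξ x hx => ⟨(h x hx _ i ξ hξ).trans ?_, (h x hx _ i ξ hξ).trans ?_⟩⟩
  all_goals
    gcongr
    exact mul_le_of_le_one_left hC.le (hone _)

theorem exists_isBdryBound (hX : 0 < P.X) (ha : ∀ j, ContinuousOn (P.a j) (Icc 0 P.X))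
    (hRH : ∀ x ∈ Icc 0 P.X, RouthHurwitz (P.coeff x)) : ∃ Ct, P.IsBdryBound Ct := by
  obtain ⟨C, _, h⟩ := P.exists_linSol_bound hX ha hRH
  exact ⟨_, fun i ξ hξ => h 0 ⟨le_rfl, hX.le⟩ _ i ξ hξ⟩

end Problem

/-! ### Global solutions of Lipschitz equations -/

/-- Picard iteration in the weighted unknown v(s) = e^{-2Ks}u(s). The weight makes the integral
operator a 1/2-contraction on the whole of [0,T], so no gluing of local solutions is needed. -/
theorem exists_hasDerivAt_of_lipschitzWith {E : Type*} [NormedAddCommGroup E] [NormedSpace ℝ E]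
    [CompleteSpace E] (F : ℝ → E → E) (hF : Continuous (Function.uncurry F)) {K : ℝ} (hK : 0 < K)
    (hLip : ∀ t v w, ‖F t v - F t w‖ ≤ K * ‖v - w‖) {T : ℝ} (hT : 0 ≤ T) (u₀ : E) :
    ∃ u : ℝ → E, u 0 = u₀ ∧ ∀ t ∈ Icc 0 T, HasDerivAt u (F t (u t)) t := by
  -- Projecting s to [0,T] makes the integrand continuous on the whole line, so that its primitive
  -- has a two-sided derivative even at 0 and T.
  let V : C(Icc (0 : ℝ) T, E) → ℝ → E := fun v s =>
    F s (Real.exp (2 * K * s) • v (projIcc 0 T hT s))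
  have hV : ∀ v, Continuous (V v) := by
    intro v
    exact hF.comp (continuous_id.prodMk (by fun_prop))
  have hprim : ∀ v x, HasDerivAt (fun x => u₀ + ∫ s in (0 : ℝ)..x, V v s) (V v x) x := by
    intro v x
    exact (intervalIntegral.integral_hasDerivAt_right ((hV v).intervalIntegrable _ _)
      ((hV v).stronglyMeasurableAtFilter _ _) (hV v).continuousAt).const_add u₀
  have hprimc : ∀ v, Continuous fun x => u₀ + ∫ s in (0 : ℝ)..x, V v s := fun v =>
    continuous_iff_continuousAt.2 fun x => (hprim v x).continuousAt
  let Q : C(Icc (0 : ℝ) T, E) → C(Icc (0 : ℝ) T, E) := fun v =>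
    ⟨fun x => Real.exp (-(2 * K * x)) • (u₀ + ∫ s in (0 : ℝ)..x, V v s), by
      have := hprimc v
      fun_prop⟩
  have hQ : ContractingWith (1 / 2) Q := by
    refine ⟨by rw [← NNReal.coe_lt_coe]; norm_num, LipschitzWith.of_dist_le_mul fun v w => ?_⟩
    rw [ContinuousMap.dist_le (by positivity)]
    intro x
    have hint : ∫ s in (0 : ℝ)..x, K * dist v w * Real.exp (2 * K * s)
        = dist v w / 2 * (Real.exp (2 * K * x) - 1) := by
      rw [intervalIntegral.integral_eq_sub_of_hasDerivAt
        (f := fun s => dist v w / 2 * Real.exp (2 * K * s))]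
      · simp; ring
      · intro s _
        have h1 : HasDerivAt (fun s : ℝ => 2 * K * s) (2 * K) s := by
          simpa using (hasDerivAt_id s).const_mul (2 * K)
        refine (h1.exp.const_mul (dist v w / 2)).congr_deriv ?_
        ring
      · exact Continuous.intervalIntegrable (by fun_prop) _ _
    have hle : ‖∫ s in (0 : ℝ)..x, (V v s - V w s)‖
        ≤ dist v w / 2 * (Real.exp (2 * K * x) - 1) := by
      rw [← hint]
      refine intervalIntegral.norm_integral_le_of_norm_le x.2.1 ?_
        (Continuous.intervalIntegrable (by fun_prop) _ _)
      refine Eventually.of_forall fun s _ => (hLip _ _ _).trans ?_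
      rw [← smul_sub, norm_smul, Real.norm_of_nonneg (Real.exp_pos _).le, ← dist_eq_norm]
      have := ContinuousMap.dist_apply_le_dist (f := v) (g := w) (projIcc 0 T hT s)
      have hexp := Real.exp_pos (2 * K * s)
      calc _ ≤ K * (Real.exp (2 * K * s) * dist v w) := by gcongr
        _ = _ := by ring
    rw [dist_eq_norm]
    change ‖Real.exp (-(2 * K * x)) • (u₀ + ∫ s in (0 : ℝ)..x, V v s)
      - Real.exp (-(2 * K * x)) • (u₀ + ∫ s in (0 : ℝ)..x, V w s)‖ ≤ _
    rw [← smul_sub, add_sub_add_left_eq_sub, ← intervalIntegral.integral_sub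
      ((hV v).intervalIntegrable _ _) ((hV w).intervalIntegrable _ _), norm_smul,
      Real.norm_of_nonneg (Real.exp_pos _).le]
    calc _ ≤ Real.exp (-(2 * K * x)) * (dist v w / 2 * (Real.exp (2 * K * x) - 1)) := by gcongr
      _ = dist v w / 2 * (1 - Real.exp (-(2 * K * x))) := by
        rw [Real.exp_neg]
        field_simp
      _ ≤ dist v w / 2 * 1 := by
        gcongr
        linarith [Real.exp_pos (-(2 * K * x))]
      _ = _ := by push_cast; ring
  obtain ⟨v, hv⟩ : ∃ v, Q v = v := ⟨_, hQ.fixedPoint_isFixedPt⟩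
  refine ⟨fun x => u₀ + ∫ s in (0 : ℝ)..x, V v s, by simp, fun t ht => ?_⟩
  refine (hprim v t).congr_deriv ?_
  simp only [V]
  congr 1
  rw [projIcc_of_mem hT ht]
  have h := congrArg (fun f : C(Icc (0 : ℝ) T, E) => f ⟨t, ht⟩) hv
  have h' : Real.exp (-(2 * K * t)) • (u₀ + ∫ s in (0 : ℝ)..t, V v s) = v ⟨t, ht⟩ := h
  rw [← h', smul_smul, ← Real.exp_add]
  simp [V]

theorem eqOn_of_hasDerivAt_of_lipschitzWith {E : Type*} [NormedAddCommGroup E] [NormedSpace ℝ E]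
    (F : ℝ → E → E) {K : NNReal} {T : ℝ} (hLip : ∀ t, LipschitzWith K (F t)) {u v : ℝ → E}
    (huc : ContinuousOn u (Icc 0 T)) (hvc : ContinuousOn v (Icc 0 T))
    (hu : ∀ t ∈ Ioo 0 T, HasDerivAt u (F t (u t)) t)
    (hv : ∀ t ∈ Ioo 0 T, HasDerivAt v (F t (v t)) t) (h0 : u 0 = v 0) :
    EqOn u v (Icc 0 T) := by
  intro t ht
  rcases eq_or_lt_of_le ht.1 with rfl | htpos
  · exact h0
  -- The equation is not assumed at 0, so Grönwall's inequality starts at δ > 0; then δ → 0 by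
  -- continuity.
  have hbd : ∀ δ ∈ Ioo 0 t, dist (u t) (v t) ≤ dist (u δ) (v δ) * Real.exp (K * (t - δ)) := by
    intro δ hδ
    have hsub : Icc δ t ⊆ Icc 0 T := Icc_subset_Icc hδ.1.le ht.2
    have hsub' : ∀ s ∈ Ico δ t, s ∈ Ioo 0 T := fun s hs =>
      ⟨hδ.1.trans_le hs.1, hs.2.trans_le ht.2⟩
    exact dist_le_of_trajectories_ODE hLip (huc.mono hsub)
      (fun s hs => (hu s (hsub' s hs)).hasDerivWithinAt) (hvc.mono hsub)
      (fun s hs => (hv s (hsub' s hs)).hasDerivWithinAt) le_rfl t ⟨hδ.2.le, le_rfl⟩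
  have hmem : (0 : ℝ) ∈ Icc 0 T := ⟨le_rfl, ht.1.trans ht.2⟩
  have hsubset : Ioo 0 t ⊆ Icc 0 T := fun s hs => ⟨hs.1.le, hs.2.le.trans ht.2⟩
  have hlim : Tendsto (fun δ => dist (u δ) (v δ) * Real.exp (K * (t - δ))) (𝓝[Ioo 0 t] 0)
      (𝓝 (dist (u 0) (v 0) * Real.exp (K * (t - 0)))) := by
    have h1 : ContinuousWithinAt u (Ioo 0 t) 0 := (huc 0 hmem).mono hsubset
    have h2 : ContinuousWithinAt v (Ioo 0 t) 0 := (hvc 0 hmem).mono hsubset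
    have h3 : Continuous fun δ : ℝ => Real.exp (K * (t - δ)) := by fun_prop
    exact (h1.dist h2).mul h3.continuousWithinAt
  have : (𝓝[Ioo 0 t] (0 : ℝ)).NeBot := by
    rw [nhdsWithin_Ioo_eq_nhdsGT htpos]; infer_instance
  have := ge_of_tendsto hlim (eventually_mem_nhdsWithin.mono hbd)
  rw [h0, dist_self, zero_mul] at this
  exact dist_le_zero.1 this

/-! ### Reduction of the Cauchy problem to a first-order system -/

theorem companion_mulVec_last {m : ℕ} (c v : Fin m → ℝ) (i : Fin m) (hi : (i : ℕ) + 1 = m) :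
    (companion c *ᵥ v) i = ∑ j, c j * v j := by
  simp [Matrix.mulVec, dotProduct, companion, hi]

theorem companion_mulVec_of_lt {m : ℕ} (c v : Fin m → ℝ) (i : Fin m) (hi : (i : ℕ) + 1 < m) :
    (companion c *ᵥ v) i = v ⟨i + 1, hi⟩ := by
  have hrow : ∀ j : Fin m, companion c i j
      = if j = (⟨i + 1, hi⟩ : Fin m) then 1 else 0 := by
    intro j
    simp [companion, hi.ne, Fin.ext_iff]
  simp [Matrix.mulVec, dotProduct, hrow]

theorem norm_companion_mulVec_le {m : ℕ} (c v : Fin m → ℝ) :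
    ‖companion c *ᵥ v‖ ≤ (1 + ∑ j, |c j|) * ‖v‖ := by
  have hnorm : ∀ w : Fin m → ℝ, ‖(fun i => (w i : ℂ))‖ = ‖w‖ := fun w => by simp [Pi.norm_def]
  have h := norm_companionOp_apply_le c fun i => (v i : ℂ)
  have he : companionOp c (fun i => (v i : ℂ)) = fun i => (((companion c *ᵥ v) i : ℝ) : ℂ) := by
    funext i
    simp [companionOp_apply, Matrix.mulVec, dotProduct]
  rwa [he, hnorm, hnorm] at h

theorem continuous_companion {m : ℕ} : Continuous fun c : Fin m → ℝ => companion c := by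
  refine continuous_matrix fun i j => ?_
  simp only [companion, Matrix.of_apply]
  split_ifs <;> fun_prop

namespace Problem

variable {m : ℕ} (P : Problem m)

/-- Right-hand side of the first-order system satisfied by `ε^i y^{(i)}(ε t)`. -/
def systemField (ε t : ℝ) (v : Fin m → ℝ) : Fin m → ℝ := fun i =>
  (companion (P.coeff (ε * t)) *ᵥ v) i + if (i : ℕ) + 1 = m then P.b (ε * t) else 0

/-- The vector of scaled derivatives `ε^i y^{(i)}(ε t)`. -/
def scaled (ε : ℝ) (y : ℝ → ℝ) (t : ℝ) : Fin m → ℝ := fun i =>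
  ε ^ (i : ℕ) * iteratedDerivWithin i y (Icc 0 P.X) (ε * t)

variable {P} {ε : ℝ}

theorem mul_mem_Icc (hε : 0 < ε) {t : ℝ} (ht : t ∈ Icc 0 (P.X / ε)) : ε * t ∈ Icc 0 P.X := by
  refine ⟨mul_nonneg hε.le ht.1, ?_⟩
  have := ht.2
  rwa [le_div_iff₀' hε] at this

theorem mul_mem_Ioo (hε : 0 < ε) {t : ℝ} (ht : t ∈ Ioo 0 (P.X / ε)) : ε * t ∈ Ioo 0 P.X := by
  refine ⟨mul_pos hε ht.1, ?_⟩
  have := ht.2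
  rwa [lt_div_iff₀' hε] at this

theorem div_mem_Icc (hε : 0 < ε) {x : ℝ} (hx : x ∈ Icc 0 P.X) : x / ε ∈ Icc 0 (P.X / ε) :=
  ⟨div_nonneg hx.1 hε.le, div_le_div_of_nonneg_right hx.2 hε.le⟩

theorem IsClassicalSolution.continuousOn_scaled (hε : 0 < ε) (hX : 0 < P.X) {y : ℝ → ℝ}
    (hy : P.IsClassicalSolution ε y) : ContinuousOn (P.scaled ε y) (Icc 0 (P.X / ε)) := by
  refine continuousOn_pi.2 fun i => continuousOn_const.mul ?_
  have h : ContinuousOn (iteratedDerivWithin i y (Icc 0 P.X)) (Icc 0 P.X) :=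
    hy.contDiffOn.continuousOn_iteratedDerivWithin
      (by have := i.2; exact_mod_cast (by omega : (i : ℕ) ≤ m - 1)) (uniqueDiffOn_Icc hX)
  exact h.comp (by fun_prop) fun t ht => mul_mem_Icc hε ht

theorem IsClassicalSolution.hasDerivAt_scaled (hε : 0 < ε) (hX : 0 < P.X) {y : ℝ → ℝ}
    (hy : P.IsClassicalSolution ε y) {t : ℝ} (ht : t ∈ Ioo 0 (P.X / ε)) :
    HasDerivAt (P.scaled ε y) (P.systemField ε t (P.scaled ε y t)) t := by
  rw [hasDerivAt_pi]
  intro i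
  have hx := mul_mem_Ioo hε ht
  have hdiff : DifferentiableWithinAt ℝ (iteratedDerivWithin i y (Icc 0 P.X)) (Icc 0 P.X)
      (ε * t) := by
    by_cases hi : (i : ℕ) + 1 = m
    · have := hy.differentiable (ε * t) ⟨hx.1, hx.2.le⟩
      rwa [show m - 1 = (i : ℕ) by omega] at this
    · refine hy.contDiffOn.differentiableOn_iteratedDerivWithin ?_ (uniqueDiffOn_Icc hX) _
        ⟨hx.1.le, hx.2.le⟩
      have := i.2
      exact_mod_cast (by omega : (i : ℕ) < m - 1)
  have hd : HasDerivAt (iteratedDerivWithin i y (Icc 0 P.X))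
      (iteratedDerivWithin (i + 1) y (Icc 0 P.X) (ε * t)) (ε * t) := by
    rw [iteratedDerivWithin_succ]
    exact hdiff.hasDerivWithinAt.hasDerivAt (Icc_mem_nhds hx.1 hx.2)
  have hlin : HasDerivAt (fun t : ℝ => ε * t) ε t := by
    simpa using (hasDerivAt_id t).const_mul ε
  refine ((hd.comp t hlin).const_mul (ε ^ (i : ℕ))).congr_deriv ?_
  by_cases hi : (i : ℕ) + 1 = m
  · have heq := hy.equation (ε * t) ⟨hx.1, hx.2.le⟩
    simp only [systemField, companion_mulVec_last _ _ i hi, if_pos hi, coeff, scaled]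
    rw [show iteratedDerivWithin (i + 1) y (Icc 0 P.X) (ε * t)
      = iteratedDerivWithin m y (Icc 0 P.X) (ε * t) by rw [hi]]
    have hpow : ε ^ m = ε ^ (i : ℕ) * ε := by rw [← pow_succ, hi]
    rw [hpow] at heq
    calc _ = ε ^ (i : ℕ) * ε * iteratedDerivWithin m y (Icc 0 P.X) (ε * t) := by ring
      _ = _ := by
        rw [heq]
        congr 1
        exact Finset.sum_congr rfl fun j _ => by ring
  · have hi' : (i : ℕ) + 1 < m := by have := i.2; omega
    simp only [systemField, companion_mulVec_of_lt _ _ i hi', if_neg hi, scaled, add_zero]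
    ring

theorem IsClassicalSolution.scaled_zero (hε : 0 < ε) {y : ℝ → ℝ}
    (hy : P.IsClassicalSolution ε y) : P.scaled ε y 0 = P.y0 := by
  funext i
  simp only [scaled, mul_zero, hy.initial i]
  field_simp

/-- Projecting time to [0, X/ε] makes the field continuous and Lipschitz for all times, as the
global existence and uniqueness results require. -/
theorem exists_lipschitz_extension (hε : 0 < ε) (hX : 0 < P.X)
    (ha : ∀ j, ContinuousOn (P.a j) (Icc 0 P.X)) (hb : ContinuousOn P.b (Icc 0 P.X)) :
    ∃ F : ℝ → (Fin m → ℝ) → (Fin m → ℝ), ∃ K : ℝ, 0 < K ∧ Continuous (Function.uncurry F) ∧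
      (∀ t v w, ‖F t v - F t w‖ ≤ K * ‖v - w‖) ∧
      ∀ t ∈ Icc 0 (P.X / ε), ∀ v, F t v = P.systemField ε t v := by
  obtain ⟨S, hS⟩ := P.exists_bound_coeff ha
  have hT : 0 ≤ P.X / ε := by positivity
  let ρ : ℝ → ℝ := fun t => projIcc 0 (P.X / ε) hT t
  have hρ : Continuous ρ := by fun_prop
  have hρm : ∀ t, ε * ρ t ∈ Icc 0 P.X := fun t => mul_mem_Icc hε (projIcc 0 (P.X / ε) hT t).2
  have hS0 : 0 < S := by
    have h1 : 0 ≤ ∑ j, |P.coeff 0 j| := Finset.sum_nonneg fun _ _ => abs_nonneg _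
    linarith [hS 0 ⟨le_rfl, hX.le⟩]
  refine ⟨fun t v => P.systemField ε (ρ t) v, S, hS0, ?_, ?_, ?_⟩
  · have hac : Continuous fun t => P.coeff (ε * ρ t) :=
      continuous_pi fun j => (ha j).comp_continuous (by fun_prop) hρm
    have hbc : Continuous fun t => P.b (ε * ρ t) := hb.comp_continuous (by fun_prop) hρm
    refine continuous_pi fun i => ?_
    simp only [Function.uncurry_def, systemField]
    refine Continuous.add ?_ ?_
    · refine (continuous_apply i).comp (Continuous.matrix_mulVec ?_ continuous_snd)
      exact continuous_companion.comp (hac.comp continuous_fst)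
    · split_ifs
      · exact hbc.comp continuous_fst
      · exact continuous_const
  · intro t v w
    have : P.systemField ε (ρ t) v - P.systemField ε (ρ t) w
        = companion (P.coeff (ε * ρ t)) *ᵥ (v - w) := by
      funext i
      simp [systemField, Matrix.mulVec_sub]
    rw [this]
    exact (norm_companion_mulVec_le _ _).trans (by gcongr; exact hS _ (hρm t))
  · intro t ht v
    simp only [ρ, projIcc_of_mem hT ht]

variable [NeZero m]

theorem IsClassicalSolution.eqOn (hε : 0 < ε) (hX : 0 < P.X)
    (ha : ∀ j, ContinuousOn (P.a j) (Icc 0 P.X)) (hb : ContinuousOn P.b (Icc 0 P.X))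
    {y w : ℝ → ℝ} (hy : P.IsClassicalSolution ε y) (hw : P.IsClassicalSolution ε w) :
    EqOn w y (Icc 0 P.X) := by
  obtain ⟨F, K, hK, -, hLip, hFeq⟩ := P.exists_lipschitz_extension hε hX ha hb
  have h := eqOn_of_hasDerivAt_of_lipschitzWith F (K := K.toNNReal) (T := P.X / ε)
    (fun t => LipschitzWith.of_dist_le_mul fun v w => by
      rw [dist_eq_norm, dist_eq_norm, Real.coe_toNNReal _ hK.le]
      exact hLip t v w)
    (hw.continuousOn_scaled hε hX) (hy.continuousOn_scaled hε hX)
    (fun t ht => by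
      rw [hFeq t (Ioo_subset_Icc_self ht)]
      exact hw.hasDerivAt_scaled hε hX ht)
    (fun t ht => by
      rw [hFeq t (Ioo_subset_Icc_self ht)]
      exact hy.hasDerivAt_scaled hε hX ht)
    (by rw [hw.scaled_zero hε, hy.scaled_zero hε])
  intro x hx
  have := congrFun (h (div_mem_Icc hε hx)) 0
  simpa [scaled, mul_div_cancel₀ x hε.ne'] using this

theorem isClassicalSolution_of_system (hε : 0 < ε) (hX : 0 < P.X) {U : ℝ → Fin m → ℝ}
    (hU : ∀ t ∈ Icc 0 (P.X / ε), HasDerivAt U (P.systemField ε t (U t)) t) (hU0 : U 0 = P.y0) :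
    P.IsClassicalSolution ε fun x => U (x / ε) 0 := by
  have hu := uniqueDiffOn_Icc hX
  have hm : 0 < m := Nat.pos_of_ne_zero (NeZero.ne m)
  have hder : ∀ i : Fin m, ∀ x ∈ Icc 0 P.X,
      HasDerivWithinAt (fun x => (ε ^ (i : ℕ))⁻¹ * U (x / ε) i)
        ((ε ^ ((i : ℕ) + 1))⁻¹ * P.systemField ε (x / ε) (U (x / ε)) i) (Icc 0 P.X) x := by
    intro i x hx
    have h1 := hasDerivAt_pi.1 (hU (x / ε) (div_mem_Icc hε hx)) i
    have h2 : HasDerivAt (fun x : ℝ => x / ε) ε⁻¹ x := by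
      simpa using (hasDerivAt_id x).div_const ε
    refine (((h1.comp x h2).const_mul (ε ^ (i : ℕ))⁻¹).congr_deriv ?_).hasDerivWithinAt
    rw [pow_succ]
    field_simp
  have hit : ∀ k (hk : k < m), EqOn (iteratedDerivWithin k (fun x => U (x / ε) 0) (Icc 0 P.X))
      (fun x => (ε ^ k)⁻¹ * U (x / ε) ⟨k, hk⟩) (Icc 0 P.X) := by
    intro k
    induction k with
    | zero =>
      intro hk x hx
      simp
    | succ k ih =>
      intro hk x hx
      rw [iteratedDerivWithin_succ, derivWithin_congr (ih (by omega)) (ih (by omega) hx),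
        (hder ⟨k, by omega⟩ x hx).derivWithin (hu x hx)]
      simp only [systemField, companion_mulVec_of_lt _ _ (⟨k, by omega⟩ : Fin m) hk, if_neg hk.ne,
        add_zero]
  have hdiff : ∀ k (hk : k < m), DifferentiableOn ℝ
      (iteratedDerivWithin k (fun x => U (x / ε) 0) (Icc 0 P.X)) (Icc 0 P.X) := by
    intro k hk x hx
    exact ((hder ⟨k, hk⟩ x hx).differentiableWithinAt).congr (hit k hk) (hit k hk hx)
  refine ⟨?_, ?_, ?_, ?_⟩
  · refine contDiffOn_of_continuousOn_differentiableOn_deriv (n := ((m - 1 : ℕ) : ℕ∞)) ?_ ?_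
    · intro k hk
      have : k ≤ m - 1 := by exact_mod_cast hk
      exact (hdiff k (by omega)).continuousOn
    · intro k hk
      have : k < m - 1 := by exact_mod_cast hk
      exact hdiff k (by omega)
  · intro x hx
    exact hdiff (m - 1) (by omega) x ⟨hx.1.le, hx.2⟩
  · intro x hx
    have hx' : x ∈ Icc 0 P.X := ⟨hx.1.le, hx.2⟩
    have hm1 : m - 1 + 1 = m := by omega
    have h : iteratedDerivWithin m (fun x => U (x / ε) 0) (Icc 0 P.X) x
        = (ε ^ m)⁻¹ * P.systemField ε (x / ε) (U (x / ε)) ⟨m - 1, by omega⟩ := by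
      have hs : ∀ g : ℝ → ℝ, iteratedDerivWithin m g (Icc 0 P.X) x
          = derivWithin (iteratedDerivWithin (m - 1) g (Icc 0 P.X)) (Icc 0 P.X) x := fun g => by
        rw [← iteratedDerivWithin_succ, hm1]
      rw [hs, derivWithin_congr (hit (m - 1) (by omega))
        (hit (m - 1) (by omega) hx'), (hder ⟨m - 1, by omega⟩ x hx').derivWithin (hu x hx')]
      simp only [hm1]
    rw [h, ← mul_assoc, mul_inv_cancel₀ (by positivity), one_mul]
    simp only [systemField, companion_mulVec_last _ _ (⟨m - 1, by omega⟩ : Fin m) hm1, if_pos hm1,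
      coeff, mul_div_cancel₀ x hε.ne']
    congr 1
    refine Finset.sum_congr rfl fun j _ => ?_
    rw [hit j j.2 hx']
    field_simp
  · intro k
    rw [hit k k.2 ⟨le_rfl, hX.le⟩]
    simp only [zero_div, hU0]
    rw [div_eq_inv_mul]

theorem exists_isClassicalSolution (hε : 0 < ε) (hX : 0 < P.X)
    (ha : ∀ j, ContinuousOn (P.a j) (Icc 0 P.X)) (hb : ContinuousOn P.b (Icc 0 P.X)) :
    ∃ y, P.IsClassicalSolution ε y := by
  obtain ⟨F, K, hK, hF, hLip, hFeq⟩ := P.exists_lipschitz_extension hε hX ha hb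
  obtain ⟨U, hU0, hU⟩ := exists_hasDerivAt_of_lipschitzWith F hF hK hLip
    (T := P.X / ε) (by positivity) P.y0
  exact ⟨_, isClassicalSolution_of_system hε hX
    (fun t ht => by rw [← hFeq t ht]; exact hU t ht) hU0⟩

end Problem

/-! ### Variation of constants -/

theorem hasDerivAt_exp_companion_entry {m : ℕ} (c : Fin m → ℝ) (t : ℝ) (i j : Fin m) :
    HasDerivAt (fun t : ℝ => NormedSpace.exp (t • companion c) i j)
      ((NormedSpace.exp (t • companion c) * companion c) i j) t := by
  have h := hasDerivAt_exp_companion c (Pi.single j 1) t i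
  have hcomm : Commute (companion c) (NormedSpace.exp (t • companion c)) :=
    ((Commute.refl (companion c)).smul_right t).exp_right
  rw [← hcomm.eq]
  simp only [Matrix.mulVec_single_one] at h
  exact h

section
attribute [local instance] Matrix.linftyOpNormedRing Matrix.linftyOpNormedAlgebra

theorem continuous_matrix_exp {m : ℕ} :
    Continuous fun M : Matrix (Fin m) (Fin m) ℝ => NormedSpace.exp M :=
  letI : NormedAlgebra ℚ (Matrix (Fin m) (Fin m) ℝ) := NormedAlgebra.restrictScalars ℚ ℝ _
  NormedSpace.exp_continuous

end

theorem continuous_exp_companion_mulVec {m : ℕ} (w : Fin m → ℝ) (i : Fin m) :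
    Continuous fun p : (Fin m → ℝ) × ℝ => (NormedSpace.exp (p.2 • companion p.1) *ᵥ w) i := by
  refine (continuous_apply i).comp (Continuous.matrix_mulVec ?_ continuous_const)
  exact continuous_matrix_exp.comp
    (continuous_snd.smul (continuous_companion.comp continuous_fst))

/-- The derivative of ζ ↦ e^{(ξ-ζ)A}z(ζ) is e^{(ξ-ζ)A}h(ζ), since the two terms containing Az
cancel. Integrate it from 0 to ξ. -/
theorem duhamel {m : ℕ} (c : Fin m → ℝ) {z h : ℝ → Fin m → ℝ} {ξ : ℝ} (hξ : 0 ≤ ξ)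
    (hz : ContinuousOn z (Icc 0 ξ)) (hh : ContinuousOn h (Icc 0 ξ))
    (hd : ∀ ζ ∈ Ioo 0 ξ, HasDerivAt z (companion c *ᵥ z ζ + h ζ) ζ) (h0 : z 0 = 0) (i : Fin m) :
    z ξ i = ∫ ζ in (0 : ℝ)..ξ, (NormedSpace.exp ((ξ - ζ) • companion c) *ᵥ h ζ) i := by
  have hexp : Continuous fun ζ : ℝ => NormedSpace.exp ((ξ - ζ) • companion c) :=
    continuous_matrix_exp.comp ((continuous_const.sub continuous_id).smul continuous_const)
  have hcont : ∀ g : ℝ → Fin m → ℝ, ContinuousOn g (Icc 0 ξ) →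
      ContinuousOn (fun ζ => (NormedSpace.exp ((ξ - ζ) • companion c) *ᵥ g ζ) i) (Icc 0 ξ) := by
    intro g hg
    simp only [Matrix.mulVec, dotProduct]
    refine continuousOn_finsetSum _ fun j _ => ContinuousOn.mul ?_ ?_
    · exact (hexp.matrix_elem i j).continuousOn
    · exact continuousOn_pi.1 hg j
  have key := intervalIntegral.integral_eq_sub_of_hasDerivAt_of_le hξ (hcont z hz)
    (f' := fun ζ => (NormedSpace.exp ((ξ - ζ) • companion c) *ᵥ h ζ) i) (fun ζ hζ => by
      have hsub : HasDerivAt (fun ζ : ℝ => ξ - ζ) (-1) ζ := by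
        simpa using (hasDerivAt_id ζ).const_sub ξ
      have hterm : ∀ j : Fin m, HasDerivAt
          (fun ζ => NormedSpace.exp ((ξ - ζ) • companion c) i j * z ζ j)
          ((NormedSpace.exp ((ξ - ζ) • companion c) * companion c) i j * (-1) * z ζ j
            + NormedSpace.exp ((ξ - ζ) • companion c) i j * (companion c *ᵥ z ζ + h ζ) j) ζ :=
        fun j => ((hasDerivAt_exp_companion_entry c (ξ - ζ) i j).comp ζ hsub).mul
          (hasDerivAt_pi.1 (hd ζ hζ) j)
      have hsum := HasDerivAt.fun_sum (u := Finset.univ) fun j _ => hterm j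
      refine hsum.congr_deriv ?_
      set M := NormedSpace.exp ((ξ - ζ) • companion c)
      have e1 : ∑ j, (M * companion c) i j * (-1) * z ζ j = -(M *ᵥ (companion c *ᵥ z ζ)) i := by
        rw [Matrix.mulVec_mulVec]
        simp [Matrix.mulVec, dotProduct]
      have e2 : ∑ j, M i j * (companion c *ᵥ z ζ + h ζ) j
          = (M *ᵥ (companion c *ᵥ z ζ)) i + (M *ᵥ h ζ) i := by
        rw [← Pi.add_apply, ← Matrix.mulVec_add]
        rfl
      rw [Finset.sum_add_distrib, e1, e2]
      ring)
    (((hcont h hh).mono (by rw [uIcc_of_le hξ])).intervalIntegrable)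
  rw [key]
  simp [h0]

/-! ### The remainder and its integral equation -/

namespace Problem

variable {m : ℕ} [NeZero m] (P : Problem m)

/-- The remainder `z` in `ε^i y^{(i)}(ε t) = δ_{i0} ȳ(ε t) + Π^{(i)}(t) + ε z_i(t)`. -/
def remainder (ε : ℝ) (y : ℝ → ℝ) (t : ℝ) : Fin m → ℝ := fun i =>
  ε⁻¹ * (P.scaled ε y t i - (if i = 0 then P.ybar (ε * t) else 0) - iteratedDeriv i P.bdry t)

/-- The boundary-layer part of the inhomogeneity. -/
def layerSource (ε t : ℝ) : ℝ :=
  ε⁻¹ * ∑ j : Fin m, (P.a j (ε * t) - P.a j 0) * iteratedDeriv j P.bdry t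

variable {P} {ε : ℝ}

theorem a_zero_neg {x : ℝ} (h : RouthHurwitz (P.coeff x)) : P.a 0 x < 0 := by
  have hm : 0 < m := Nat.pos_of_ne_zero (NeZero.ne m)
  have := h 1 le_rfl hm
  simp [hurwitzEntry, hm] at this
  exact this

theorem contDiffOn_ybar (ha : ∀ j, ContDiffOn ℝ 1 (P.a j) (Icc 0 P.X))
    (hb : ContDiffOn ℝ 1 P.b (Icc 0 P.X))
    (hRH : ∀ x ∈ Icc 0 P.X, RouthHurwitz (P.coeff x)) : ContDiffOn ℝ 1 P.ybar (Icc 0 P.X) :=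
  hb.neg.div (ha 0) fun x hx => (a_zero_neg (hRH x hx)).ne

theorem continuousOn_ybar' (hX : 0 < P.X) (hy : ContDiffOn ℝ 1 P.ybar (Icc 0 P.X)) :
    ContinuousOn P.ybar' (Icc 0 P.X) :=
  hy.continuousOn_derivWithin (uniqueDiffOn_Icc hX) le_rfl

theorem hasDerivAt_ybar (hy : ContDiffOn ℝ 1 P.ybar (Icc 0 P.X)) {x : ℝ} (hx : x ∈ Ioo 0 P.X) :
    HasDerivAt P.ybar (P.ybar' x) x :=
  ((hy.differentiableOn one_ne_zero x (Ioo_subset_Icc_self hx)).hasDerivWithinAt).hasDerivAt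
    (Icc_mem_nhds hx.1 hx.2)

theorem hasDerivAt_iteratedDeriv_bdry (t : ℝ) (i : Fin m) :
    HasDerivAt (iteratedDeriv i P.bdry)
      ((companion (P.coeff 0) *ᵥ fun j => iteratedDeriv j P.bdry t) i) t := by
  simp only [bdry, iteratedDeriv_linSol]
  exact hasDerivAt_exp_companion _ _ t i

theorem continuous_iteratedDeriv_bdry (i : Fin m) : Continuous (iteratedDeriv i P.bdry) :=
  continuous_iff_continuousAt.2 fun t => (hasDerivAt_iteratedDeriv_bdry t i).continuousAt

theorem remainder_zero (hε : 0 < ε) {y : ℝ → ℝ} (hy : P.IsClassicalSolution ε y) :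
    P.remainder ε y 0 = 0 := by
  funext i
  have h1 := congrFun (hy.scaled_zero hε) i
  simp only [remainder, h1, mul_zero, bdry, linSol_initial]
  split_ifs with h
  · subst h; simp
  · simp

theorem continuousOn_remainder (hε : 0 < ε) (hX : 0 < P.X)
    (hyb : ContinuousOn P.ybar (Icc 0 P.X)) {y : ℝ → ℝ} (hy : P.IsClassicalSolution ε y) :
    ContinuousOn (P.remainder ε y) (Icc 0 (P.X / ε)) := by
  refine continuousOn_pi.2 fun i => continuousOn_const.mul ?_
  refine ((continuousOn_pi.1 (hy.continuousOn_scaled hε hX) i).sub ?_).sub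
    (continuous_iteratedDeriv_bdry i).continuousOn
  split_ifs
  · exact hyb.comp (by fun_prop) fun t ht => mul_mem_Icc hε ht
  · exact continuousOn_const

theorem hasDerivAt_remainder (hε : 0 < ε) (hX : 0 < P.X)
    (hyb : ContDiffOn ℝ 1 P.ybar (Icc 0 P.X))
    (hRH : ∀ x ∈ Icc 0 P.X, RouthHurwitz (P.coeff x)) {y : ℝ → ℝ}
    (hy : P.IsClassicalSolution ε y) {t : ℝ} (ht : t ∈ Ioo 0 (P.X / ε)) :
    HasDerivAt (P.remainder ε y) (companion (P.coeff (ε * t)) *ᵥ P.remainder ε y t + fun i : Fin m =>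
      (if i = 0 then -P.ybar' (ε * t) else 0)
        + if (i : ℕ) + 1 = m then P.layerSource ε t else 0) t := by
  rw [hasDerivAt_pi]
  intro i
  have hx := mul_mem_Ioo hε ht
  have hlin : HasDerivAt (fun t : ℝ => ε * t) ε t := by
    simpa using (hasDerivAt_id t).const_mul ε
  have hd1 := hasDerivAt_pi.1 (hy.hasDerivAt_scaled hε hX ht) i
  have hd2 : HasDerivAt (fun t => if i = 0 then P.ybar (ε * t) else 0)
      (if i = 0 then P.ybar' (ε * t) * ε else 0) t := by
    split_ifs
    · exact (hasDerivAt_ybar hyb hx).comp t hlin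
    · exact hasDerivAt_const t 0
  have hd := ((hd1.sub hd2).sub (hasDerivAt_iteratedDeriv_bdry (P := P) t i)).const_mul ε⁻¹
  refine hd.congr_deriv ?_
  have hU : ∀ j, P.scaled ε y t j = ε * P.remainder ε y t j
      + (if j = 0 then P.ybar (ε * t) else 0) + iteratedDeriv j P.bdry t := by
    intro j
    simp only [remainder]
    field_simp
    ring
  simp only [systemField, Pi.add_apply]
  by_cases hi : (i : ℕ) + 1 = m
  · have ha0 : P.a 0 (ε * t) * P.ybar (ε * t) = -P.b (ε * t) := by
      have := (a_zero_neg (hRH _ (Ioo_subset_Icc_self hx))).ne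
      rw [ybar]; field_simp
    have hsum : ∑ j, P.coeff (ε * t) j * P.scaled ε y t j
        = ε * ∑ j, P.coeff (ε * t) j * P.remainder ε y t j - P.b (ε * t)
          + ∑ j, P.coeff (ε * t) j * iteratedDeriv j P.bdry t := by
      simp only [hU, mul_add, Finset.sum_add_distrib, mul_ite, mul_zero, Finset.sum_ite_eq',
        Finset.mem_univ, if_true]
      rw [show P.coeff (ε * t) 0 = P.a 0 (ε * t) from rfl, ha0, Finset.mul_sum]
      congr 1
      rw [sub_eq_add_neg]
      congr 1
      exact Finset.sum_congr rfl fun j _ => by ring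
    have hsrc : ε * P.layerSource ε t = ∑ j, P.coeff (ε * t) j * iteratedDeriv j P.bdry t
        - ∑ j, P.coeff 0 j * iteratedDeriv j P.bdry t := by
      rw [layerSource, mul_inv_cancel_left₀ hε.ne', ← Finset.sum_sub_distrib]
      exact Finset.sum_congr rfl fun j _ => by simp only [coeff]; ring
    simp only [companion_mulVec_last _ _ i hi, if_pos hi, hsum]
    have hs : P.layerSource ε t = ε⁻¹ * (∑ j, P.coeff (ε * t) j * iteratedDeriv j P.bdry t
        - ∑ j, P.coeff 0 j * iteratedDeriv j P.bdry t) := by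
      rw [← hsrc, inv_mul_cancel_left₀ hε.ne']
    rw [hs]
    split_ifs
    · field_simp; ring
    · field_simp; ring
  · have hi' : (i : ℕ) + 1 < m := by have := i.2; omega
    have hne : (⟨i + 1, hi'⟩ : Fin m) ≠ 0 := by
      intro h
      have := congrArg Fin.val h
      simp at this
    simp only [companion_mulVec_of_lt _ _ i hi', if_neg hi, hU ⟨i + 1, hi'⟩, if_neg hne, add_zero]
    split_ifs
    · field_simp; ring
    · field_simp; ring

theorem iteratedDeriv_Phi1 (x t : ℝ) (i : Fin m) : iteratedDeriv i (P.Phi1 x) t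
    = (NormedSpace.exp (t • companion (P.coeff x)) *ᵥ fun k => if k = 0 then 1 else 0) i := by
  rw [Phi1, iteratedDeriv_linSol]

theorem iteratedDeriv_Phim (x t : ℝ) (i : Fin m) : iteratedDeriv i (P.Phim x) t
    = (NormedSpace.exp (t • companion (P.coeff x)) *ᵥ
        fun k => if (k : ℕ) + 1 = m then 1 else 0) i := by
  rw [Phim, iteratedDeriv_linSol]

theorem continuous_iteratedDeriv_Phi1 (x ξ : ℝ) (i : Fin m) :
    Continuous fun ζ => iteratedDeriv i (P.Phi1 x) (ξ - ζ) := by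
  simp only [iteratedDeriv_Phi1]
  exact (continuous_exp_companion_mulVec _ i).comp
    (continuous_const.prodMk (continuous_const.sub continuous_id))

theorem continuous_iteratedDeriv_Phim (x ξ : ℝ) (i : Fin m) :
    Continuous fun ζ => iteratedDeriv i (P.Phim x) (ξ - ζ) := by
  simp only [iteratedDeriv_Phim]
  exact (continuous_exp_companion_mulVec _ i).comp
    (continuous_const.prodMk (continuous_const.sub continuous_id))

theorem continuousOn_layerSource (hε : 0 < ε) (ha : ∀ j, ContinuousOn (P.a j) (Icc 0 P.X)) :
    ContinuousOn (P.layerSource ε) (Icc 0 (P.X / ε)) := by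
  refine continuousOn_const.mul (continuousOn_finsetSum _ fun j _ => ContinuousOn.mul ?_ ?_)
  · exact ((ha j).comp (by fun_prop) fun t ht => mul_mem_Icc hε ht).sub continuousOn_const
  · exact (continuous_iteratedDeriv_bdry j).continuousOn

theorem f_of_eq_one (hm : m = 1) (t : ℝ) : P.f ε t = P.layerSource ε t - P.ybar' (ε * t) := by
  subst hm
  simp [f, layerSource]

theorem f_of_ne_one (hm : m ≠ 1) (t : ℝ) : P.f ε t = P.layerSource ε t := by
  simp [f, layerSource, hm]

/-- For fixed ξ the coefficients are frozen at εξ, and the difference to those at εζ goes into the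
source in the last row. The first column of the exponential yields Φ¹ and the last one Φᵐ. -/
theorem remainder_eq_opA (hε : 0 < ε) (hX : 0 < P.X)
    (ha : ∀ j, ContinuousOn (P.a j) (Icc 0 P.X))
    (hyb : ContDiffOn ℝ 1 P.ybar (Icc 0 P.X))
    (hRH : ∀ x ∈ Icc 0 P.X, RouthHurwitz (P.coeff x)) {y : ℝ → ℝ}
    (hy : P.IsClassicalSolution ε y) {ξ : ℝ} (hξ : ξ ∈ Icc 0 (P.X / ε)) (i : Fin m) :
    P.remainder ε y ξ i = P.opA ε (P.remainder ε y) ξ i := by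
  set z := P.remainder ε y with hz
  have hsub : Icc 0 ξ ⊆ Icc 0 (P.X / ε) := Icc_subset_Icc le_rfl hξ.2
  have hzc : ContinuousOn z (Icc 0 ξ) :=
    (continuousOn_remainder hε hX hyb.continuousOn hy).mono hsub
  have hybc : ContinuousOn (fun ζ => P.ybar' (ε * ζ)) (Icc 0 ξ) :=
    (continuousOn_ybar' hX hyb).comp (by fun_prop) fun t ht => mul_mem_Icc hε (hsub ht)
  have hac : ∀ j, ContinuousOn (fun ζ => P.a j (ε * ζ)) (Icc 0 ξ) := fun j =>
    (ha j).comp (by fun_prop) fun t ht => mul_mem_Icc hε (hsub ht)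
  let g : ℝ → ℝ := fun ζ => ∑ j : Fin m, (P.a j (ε * ζ) - P.a j (ε * ξ)) * z ζ j
    + P.layerSource ε ζ
  have hgc : ContinuousOn g (Icc 0 ξ) :=
    (continuousOn_finsetSum _ fun j _ => ((hac j).sub continuousOn_const).mul
      (continuousOn_pi.1 hzc j)).add ((continuousOn_layerSource hε ha).mono hsub)
  have hduh := duhamel (P.coeff (ε * ξ)) (z := z)
    (h := fun ζ i => (if i = 0 then -P.ybar' (ε * ζ) else 0) + if (i : ℕ) + 1 = m then g ζ else 0)
    hξ.1 hzc (by
      refine continuousOn_pi.2 fun i => ContinuousOn.add ?_ ?_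
      · split_ifs
        · exact hybc.neg
        · exact continuousOn_const
      · split_ifs
        · exact hgc
        · exact continuousOn_const)
    (fun ζ hζ => by
      refine (hasDerivAt_remainder hε hX hyb hRH hy
        ⟨hζ.1, hζ.2.trans_le hξ.2⟩).congr_deriv ?_
      funext i
      simp only [Pi.add_apply, ← hz]
      by_cases hi : (i : ℕ) + 1 = m
      · simp only [companion_mulVec_last _ _ i hi, if_pos hi, g, coeff, sub_mul,
          Finset.sum_sub_distrib]
        ring
      · have hi' : (i : ℕ) + 1 < m := by have := i.2; omega
        simp only [companion_mulVec_of_lt _ _ i hi', if_neg hi])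
    (remainder_zero hε hy) i
  rw [hduh]
  have hsplit : ∀ ζ, (NormedSpace.exp ((ξ - ζ) • companion (P.coeff (ε * ξ))) *ᵥ
      fun i : Fin m => (if i = 0 then -P.ybar' (ε * ζ) else 0)
        + if (i : ℕ) + 1 = m then g ζ else 0) i
      = -(iteratedDeriv i (P.Phi1 (ε * ξ)) (ξ - ζ) * P.ybar' (ε * ζ))
        + iteratedDeriv i (P.Phim (ε * ξ)) (ξ - ζ) * g ζ := by
    intro ζ
    rw [iteratedDeriv_Phi1, iteratedDeriv_Phim]
    simp only [Matrix.mulVec, dotProduct, Finset.sum_mul, ← Finset.sum_neg_distrib,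
      ← Finset.sum_add_distrib]
    refine Finset.sum_congr rfl fun j _ => ?_
    split_ifs <;> ring
  simp only [hsplit, opA]
  by_cases hm : m = 1
  · have hPhi : P.Phi1 (ε * ξ) = P.Phim (ε * ξ) := by
      unfold Phi1 Phim
      congr 1
      funext k
      have h1 : k = 0 := by subst hm; exact Subsingleton.elim _ _
      have h2 : (k : ℕ) + 1 = m := by have := k.2; omega
      rw [if_pos h1, if_pos h2]
    simp only [if_pos hm, zero_add, f_of_eq_one hm, hPhi]
    congr 1
    funext ζ
    simp only [g]
    ring
  · simp only [if_neg hm, f_of_ne_one hm]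
    rw [← intervalIntegral.integral_neg, ← intervalIntegral.integral_add]
    · exact (((continuous_iteratedDeriv_Phi1 _ ξ i).continuousOn.mul hybc).neg.mono
        (by rw [uIcc_of_le hξ.1])).intervalIntegrable
    · exact (((continuous_iteratedDeriv_Phim _ ξ i).continuousOn.mul hgc).mono
        (by rw [uIcc_of_le hξ.1])).intervalIntegrable

end Problem

/-! ### Estimates of the integral operator -/

theorem abs_le_supNorm {X : ℝ} {g : ℝ → ℝ} (hg : ContinuousOn g (Icc 0 X)) {x : ℝ}
    (hx : x ∈ Icc 0 X) : |g x| ≤ supNorm X g :=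
  le_csSup (isCompact_Icc.bddAbove_image hg.abs) (mem_image_of_mem (fun x => |g x|) hx)

theorem supNorm_nonneg (X : ℝ) (g : ℝ → ℝ) : 0 ≤ supNorm X g :=
  Real.sSup_nonneg (by rintro _ ⟨x, _, rfl⟩; exact abs_nonneg _)

theorem abs_sub_le_supNorm_mul {X : ℝ} (hX : 0 < X) {g : ℝ → ℝ} (hg : ContDiffOn ℝ 1 g (Icc 0 X))
    {x y : ℝ} (hx : x ∈ Icc 0 X) (hy : y ∈ Icc 0 X) :
    |g y - g x| ≤ supNorm X (derivWithin g (Icc 0 X)) * |y - x| :=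
  Convex.norm_image_sub_le_of_norm_derivWithin_le (hg.differentiableOn one_ne_zero)
    (fun _ h => abs_le_supNorm (hg.continuousOn_derivWithin (uniqueDiffOn_Icc hX) le_rfl) h)
    (convex_Icc 0 X) hx hy

/-- Integration by parts, by induction on n; the boundary term at ξ has a favourable sign and is
dropped. -/
theorem integral_pow_mul_exp_le {χ ξ : ℝ} (hχ : 0 < χ) (hξ : 0 ≤ ξ) (n : ℕ) :
    ∫ t in (0 : ℝ)..ξ, t ^ n * Real.exp (-χ * t) ≤ n.factorial / χ ^ (n + 1) := by
  have hexp : ∀ t : ℝ, HasDerivAt (fun t : ℝ => Real.exp (-χ * t)) (Real.exp (-χ * t) * -χ) t := by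
    intro t
    have h1 : HasDerivAt (fun t : ℝ => -χ * t) (-χ) t := by
      simpa using (hasDerivAt_id t).const_mul (-χ)
    exact h1.exp
  have hint : ∀ n : ℕ, IntervalIntegrable (fun t : ℝ => t ^ n * Real.exp (-χ * t)) volume 0 ξ :=
    fun n => Continuous.intervalIntegrable (by fun_prop) _ _
  induction n with
  | zero =>
    have h := intervalIntegral.integral_eq_sub_of_hasDerivAt (a := 0) (b := ξ)
      (fun t _ => hexp t) (Continuous.intervalIntegrable (by fun_prop) _ _)
    rw [intervalIntegral.integral_mul_const] at h
    simp only [pow_zero, one_mul, Nat.factorial_zero, Nat.cast_one, zero_add, pow_one, mul_zero,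
      Real.exp_zero] at h ⊢
    rw [le_div_iff₀ hχ]
    linarith [Real.exp_pos (-χ * ξ)]
  | succ n ih =>
    have h := intervalIntegral.integral_eq_sub_of_hasDerivAt (a := 0) (b := ξ)
      (f := fun t : ℝ => t ^ (n + 1) * Real.exp (-χ * t))
      (f' := fun t => (n + 1) * (t ^ n * Real.exp (-χ * t))
        - χ * (t ^ (n + 1) * Real.exp (-χ * t)))
      (fun t _ => ((hasDerivAt_pow (n + 1) t).mul (hexp t)).congr_deriv (by
        push_cast; ring))
      (Continuous.intervalIntegrable (by fun_prop) _ _)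
    rw [intervalIntegral.integral_sub ((hint n).const_mul _) ((hint (n + 1)).const_mul _),
      intervalIntegral.integral_const_mul, intervalIntegral.integral_const_mul] at h
    have hpos : 0 ≤ ξ ^ (n + 1) * Real.exp (-χ * ξ) := by positivity
    have hz : (0 : ℝ) ^ (n + 1) * Real.exp (-χ * 0) = 0 := by simp
    rw [hz, sub_zero] at h
    have hle : χ * ∫ t in (0 : ℝ)..ξ, t ^ (n + 1) * Real.exp (-χ * t)
        ≤ (n + 1) * (n.factorial / χ ^ (n + 1)) := by
      have : ((n : ℝ) + 1) * ∫ t in (0 : ℝ)..ξ, t ^ n * Real.exp (-χ * t)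
          ≤ (n + 1) * (n.factorial / χ ^ (n + 1)) := by gcongr
      linarith
    rw [Nat.factorial_succ, pow_succ, le_div_iff₀ (by positivity)]
    push_cast
    calc _ = χ ^ (n + 1) * (χ * ∫ t in (0 : ℝ)..ξ, t ^ (n + 1) * Real.exp (-χ * t)) := by ring
      _ ≤ χ ^ (n + 1) * ((n + 1) * (n.factorial / χ ^ (n + 1))) := by gcongr
      _ = _ := by field_simp

theorem integral_kernel_le {χ ξ : ℝ} (hχ : 0 < χ) (hξ : 0 ≤ ξ) {m : ℕ} (hm : 0 < m) :
    ∫ ζ in (0 : ℝ)..ξ, (1 + (ξ - ζ) ^ (m - 1)) * Real.exp (-χ * (ξ - ζ))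
      ≤ (χ ^ (m - 1) + (m - 1).factorial) / χ ^ m := by
  rw [intervalIntegral.integral_comp_sub_left
    (fun t => (1 + t ^ (m - 1)) * Real.exp (-χ * t)) ξ, sub_self, sub_zero]
  have h0 := integral_pow_mul_exp_le hχ hξ 0
  have h1 := integral_pow_mul_exp_le hχ hξ (m - 1)
  have e : (fun t : ℝ => (1 + t ^ (m - 1)) * Real.exp (-χ * t))
      = fun t => t ^ 0 * Real.exp (-χ * t) + t ^ (m - 1) * Real.exp (-χ * t) := by
    funext t; ring
  rw [e, intervalIntegral.integral_add (Continuous.intervalIntegrable (by fun_prop) _ _)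
    (Continuous.intervalIntegrable (by fun_prop) _ _)]
  refine (add_le_add h0 h1).trans (le_of_eq ?_)
  obtain ⟨k, rfl⟩ : ∃ k, m = k + 1 := ⟨m - 1, by omega⟩
  simp only [Nat.add_sub_cancel, Nat.factorial_zero, Nat.cast_one, zero_add, pow_one]
  field_simp
  ring

theorem integral_mul_kernel_le {χ ξ : ℝ} (hχ : 0 < χ) (hξ : 0 ≤ ξ) {m : ℕ} (hm : 0 < m) :
    ∫ ζ in (0 : ℝ)..ξ, (ξ - ζ) * ((1 + (ξ - ζ) ^ (m - 1)) * Real.exp (-χ * (ξ - ζ)))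
      ≤ (χ ^ (m - 1) + m.factorial) / χ ^ (m + 1) := by
  rw [intervalIntegral.integral_comp_sub_left
    (fun t => t * ((1 + t ^ (m - 1)) * Real.exp (-χ * t))) ξ, sub_self, sub_zero]
  have h0 := integral_pow_mul_exp_le hχ hξ 1
  have h1 := integral_pow_mul_exp_le hχ hξ m
  obtain ⟨k, rfl⟩ : ∃ k, m = k + 1 := ⟨m - 1, by omega⟩
  simp only [Nat.add_sub_cancel]
  have e : (fun t : ℝ => t * ((1 + t ^ k) * Real.exp (-χ * t)))
      = fun t => t ^ 1 * Real.exp (-χ * t) + t ^ (k + 1) * Real.exp (-χ * t) := by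
    funext t; ring
  rw [e, intervalIntegral.integral_add (Continuous.intervalIntegrable (by fun_prop) _ _)
    (Continuous.intervalIntegrable (by fun_prop) _ _)]
  refine (add_le_add h0 h1).trans (le_of_eq ?_)
  simp only [Nat.factorial_one, Nat.cast_one]
  field_simp
  ring

/-- Without boundedness the supremum in γ would take the default value 0 and bound nothing. -/
theorem bddAbove_add_pow_mul_exp {χ : ℝ} (hχ : 0 < χ) (m : ℕ) :
    BddAbove ((fun ζ : ℝ => (ζ + ζ ^ m) * Real.exp (-χ * ζ)) '' Ioi 0) := by
  refine ⟨1 / χ + m.factorial / χ ^ m, ?_⟩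
  rintro _ ⟨ζ, hζ, rfl⟩
  have hζ0 : 0 ≤ ζ := le_of_lt hζ
  have hb : ∀ n : ℕ, ζ ^ n * Real.exp (-χ * ζ) ≤ n.factorial / χ ^ n := by
    intro n
    have h := Real.pow_div_factorial_le_exp (χ * ζ) (by positivity) n
    rw [neg_mul, Real.exp_neg, ← div_eq_mul_inv, div_le_div_iff₀ (Real.exp_pos _) (by positivity)]
    rw [div_le_iff₀ (by positivity), mul_pow] at h
    linarith
  have h1 := hb 1
  have h2 := hb m
  simp only [pow_one, Nat.factorial_one, Nat.cast_one] at h1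
  simp only [add_mul]
  linarith

/-! ### Constants, continuity and Lipschitz bound of the integral operator -/

namespace Problem

variable {m : ℕ} {P : Problem m} {ε : ℝ}

theorem alpha_nonneg : 0 ≤ P.alpha := Finset.sum_nonneg fun _ _ => supNorm_nonneg _ _

theorem beta_nonneg (hχ : 0 < P.chi) : 0 ≤ P.beta := by
  have := P.alpha_nonneg
  unfold beta
  positivity

theorem sSup_layer_nonneg :
    0 ≤ sSup ((fun ζ : ℝ => (ζ + ζ ^ m) * Real.exp (-P.chi * ζ)) '' Ioi 0) := by
  refine Real.sSup_nonneg ?_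
  rintro _ ⟨ζ, hζ, rfl⟩
  have : (0 : ℝ) < ζ := hζ
  positivity

theorem sum_abs_coeff_sub_mul_le (hX : 0 < P.X)
    (ha : ∀ j, ContDiffOn ℝ 1 (P.a j) (Icc 0 P.X)) {x x' D : ℝ} (hx : x ∈ Icc 0 P.X)
    (hx' : x' ∈ Icc 0 P.X) {v : Fin m → ℝ} (hv : ∀ j, |v j| ≤ D) :
    |∑ j, (P.a j x - P.a j x') * v j| ≤ P.alpha * |x - x'| * D := by
  rw [alpha, Finset.sum_mul, Finset.sum_mul]
  refine (Finset.abs_sum_le_sum_abs _ _).trans (Finset.sum_le_sum fun j _ => ?_)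
  rw [abs_mul]
  exact mul_le_mul (abs_sub_le_supNorm_mul hX (ha j) hx' hx) (hv j) (abs_nonneg _)
    (mul_nonneg (supNorm_nonneg _ _) (abs_nonneg _))

/-- If β = 0, then ε₀ = ∞ and both sides are 0; this removes extended arithmetic from all later
estimates. -/
theorem rate_eq (hχ : 0 < P.chi) {γ₀ CΦ : ℝ} (hγ : 0 < γ₀) (hC : 0 < CΦ) (hε : 0 < ε) :
    P.rate γ₀ CΦ ε = CΦ * P.beta * ε := by
  have hB : 0 ≤ CΦ * P.beta := mul_nonneg hC.le (P.beta_nonneg hχ)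
  rw [rate, eps0]
  rcases hB.eq_or_lt with h | h
  · rw [← h]
    simp [ENNReal.div_zero, hγ]
  · rw [← ENNReal.ofReal_div_of_pos h, ← ENNReal.ofReal_div_of_pos (by positivity),
      ENNReal.toReal_ofReal (by positivity)]
    field_simp

theorem le_of_le_eps0 (hχ : 0 < P.chi) {γ₀ CΦ : ℝ} (hγ : 0 < γ₀) (hC : 0 < CΦ)
    (h : ENNReal.ofReal ε ≤ P.eps0 γ₀ CΦ) : CΦ * P.beta * ε ≤ γ₀ := by
  have hB : 0 ≤ CΦ * P.beta := mul_nonneg hC.le (P.beta_nonneg hχ)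
  rcases hB.eq_or_lt with h0 | h0
  · rw [← h0, zero_mul]; exact hγ.le
  · rw [eps0, ← ENNReal.ofReal_div_of_pos h0, ENNReal.ofReal_le_ofReal_iff (by positivity),
      le_div_iff₀' h0] at h
    exact h

theorem eps0_pos {γ₀ CΦ : ℝ} (hγ : 0 < γ₀) : 0 < P.eps0 γ₀ CΦ :=
  ENNReal.div_pos (by simpa using hγ) ENNReal.ofReal_ne_top

variable [NeZero m]

theorem IsBdryBound.nonneg {Ct : ℝ} (h : P.IsBdryBound Ct) : 0 ≤ Ct := by
  have := (abs_nonneg _).trans (h 0 0 le_rfl)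
  simp only [mul_zero, Real.exp_zero, mul_one] at this
  have h0 : (0 : ℝ) ≤ 0 ^ (m - 1) := by positivity
  by_contra! hn
  nlinarith

theorem gam_nonneg (hχ : 0 < P.chi) {Ct : ℝ} (hCt : 0 ≤ Ct) : 0 ≤ P.gam Ct := by
  have h1 := P.alpha_nonneg
  have h2 := P.sSup_layer_nonneg
  have h3 := supNorm_nonneg P.X P.ybar'
  unfold gam
  positivity

/-- The increment of the coefficients contributes αεζ, which cancels ε⁻¹ and turns the bound 1 +
ζ^{m-1} for Π into ζ + ζ^m. -/
theorem abs_layerSource_le (hε : 0 < ε) (hX : 0 < P.X) (hχ : 0 < P.chi)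
    (ha : ∀ j, ContDiffOn ℝ 1 (P.a j) (Icc 0 P.X)) {Ct : ℝ} (hCt : P.IsBdryBound Ct) {ζ : ℝ}
    (hζ : ζ ∈ Icc 0 (P.X / ε)) (hζ0 : 0 < ζ) :
    |P.layerSource ε ζ| ≤ Ct * P.alpha *
      sSup ((fun ζ : ℝ => (ζ + ζ ^ m) * Real.exp (-P.chi * ζ)) '' Ioi 0) := by
  have h1 := sum_abs_coeff_sub_mul_le hX ha (mul_mem_Icc hε hζ) ⟨le_rfl, hX.le⟩
    fun j => hCt j ζ hζ.1
  have h2 := le_csSup (bddAbove_add_pow_mul_exp hχ m)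
    (mem_image_of_mem (fun ζ : ℝ => (ζ + ζ ^ m) * Real.exp (-P.chi * ζ)) (mem_Ioi.2 hζ0))
  have hpow : ζ ^ m = ζ * ζ ^ (m - 1) := by
    rw [← pow_succ', Nat.sub_add_cancel (Nat.pos_of_ne_zero (NeZero.ne m))]
  have hα := P.alpha_nonneg
  have hC := hCt.nonneg
  rw [layerSource, abs_mul, abs_of_pos (inv_pos.2 hε)]
  rw [sub_zero, abs_of_nonneg (mul_nonneg hε.le hζ0.le)] at h1
  calc _ ≤ ε⁻¹ * (P.alpha * (ε * ζ) * (Ct * (1 + ζ ^ (m - 1)) * Real.exp (-P.chi * ζ))) := by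
        gcongr
    _ = Ct * P.alpha * ((ζ + ζ ^ m) * Real.exp (-P.chi * ζ)) := by
        rw [hpow]; field_simp
    _ ≤ _ := by gcongr

theorem continuousOn_f (hε : 0 < ε) (ha : ∀ j, ContinuousOn (P.a j) (Icc 0 P.X))
    (hyb : ContinuousOn P.ybar' (Icc 0 P.X)) : ContinuousOn (P.f ε) (Icc 0 (P.X / ε)) := by
  by_cases hm : m = 1
  · simp only [funext (f_of_eq_one hm)]
    exact (continuousOn_layerSource hε ha).sub
      (hyb.comp (by fun_prop) fun t ht => mul_mem_Icc hε ht)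
  · simp only [funext (f_of_ne_one hm)]
    exact continuousOn_layerSource hε ha

theorem continuousOn_opA_integrand (hε : 0 < ε) (ha : ∀ j, ContinuousOn (P.a j) (Icc 0 P.X))
    (hyb : ContinuousOn P.ybar' (Icc 0 P.X)) {z : ℝ → Fin m → ℝ}
    (hz : ContinuousOn z (Icc 0 (P.X / ε))) (x : ℝ) :
    ContinuousOn (fun ζ => ∑ j : Fin m, (P.a j (ε * ζ) - P.a j x) * z ζ j + P.f ε ζ)
      (Icc 0 (P.X / ε)) := by
  refine (continuousOn_finsetSum _ fun j _ => ContinuousOn.mul ?_ (continuousOn_pi.1 hz j)).add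
    (continuousOn_f hε ha hyb)
  exact ((ha j).comp (by fun_prop) fun t ht => mul_mem_Icc hε ht).sub continuousOn_const

/-- ξ enters both the limit and the integrand. Composing with the projection ρ makes the integrand
jointly continuous on the plane without changing it on the domain of interest. -/
theorem continuousOn_opA (hε : 0 < ε) (hX : 0 < P.X)
    (ha : ∀ j, ContinuousOn (P.a j) (Icc 0 P.X)) (hyb : ContinuousOn P.ybar' (Icc 0 P.X))
    {z : ℝ → Fin m → ℝ} (hz : ContinuousOn z (Icc 0 (P.X / ε))) :
    ContinuousOn (P.opA ε z) (Icc 0 (P.X / ε)) := by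
  have hT : 0 ≤ P.X / ε := by positivity
  let ρ : ℝ → ℝ := fun t => projIcc 0 (P.X / ε) hT t
  have hρ : Continuous ρ := by fun_prop
  have hρm : ∀ t, ρ t ∈ Icc 0 (P.X / ε) := fun t => (projIcc 0 (P.X / ε) hT t).2
  have hρe : ∀ t ∈ Icc 0 (P.X / ε), ρ t = t := fun t ht => by simp only [ρ, projIcc_of_mem hT ht]
  have hρx : ∀ t, ε * ρ t ∈ Icc 0 P.X := fun t => mul_mem_Icc hε (hρm t)
  have hcoef : Continuous fun t => P.coeff (ε * ρ t) :=
    continuous_pi fun j => (ha j).comp_continuous (by fun_prop) hρx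
  have hac : ∀ j, Continuous fun t => P.a j (ε * ρ t) := fun j => continuous_pi_iff.1 hcoef j
  have hybc : Continuous fun t => P.ybar' (ε * ρ t) := hyb.comp_continuous (by fun_prop) hρx
  have hfc : Continuous fun t => P.f ε (ρ t) := (continuousOn_f hε ha hyb).comp_continuous hρ hρm
  have hzc : Continuous fun t => z (ρ t) := hz.comp_continuous hρ hρm
  have hker : ∀ (w : Fin m → ℝ) (i : Fin m), Continuous fun p : ℝ × ℝ =>
      (NormedSpace.exp ((p.1 - p.2) • companion (P.coeff (ε * ρ p.1))) *ᵥ w) i := fun w i =>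
    (continuous_exp_companion_mulVec w i).comp
      ((hcoef.comp continuous_fst).prodMk (continuous_fst.sub continuous_snd))
  refine continuousOn_pi.2 fun i => ?_
  have h1 : Continuous fun ξ => ∫ ζ in (0 : ℝ)..ξ,
      iteratedDeriv i (P.Phi1 (ε * ρ ξ)) (ξ - ζ) * P.ybar' (ε * ρ ζ) := by
    refine intervalIntegral.continuous_parametric_intervalIntegral_of_continuous ?_ continuous_id
    simp only [iteratedDeriv_Phi1, Function.uncurry_def]
    exact (hker _ i).mul (hybc.comp continuous_snd)
  have h2 : Continuous fun ξ => ∫ ζ in (0 : ℝ)..ξ, iteratedDeriv i (P.Phim (ε * ρ ξ)) (ξ - ζ) *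
      (∑ j : Fin m, (P.a j (ε * ρ ζ) - P.a j (ε * ρ ξ)) * z (ρ ζ) j + P.f ε (ρ ζ)) := by
    refine intervalIntegral.continuous_parametric_intervalIntegral_of_continuous ?_ continuous_id
    simp only [iteratedDeriv_Phim, Function.uncurry_def]
    refine (hker _ i).mul (Continuous.add ?_ (hfc.comp continuous_snd))
    refine continuous_finsetSum _ fun j _ => Continuous.mul ?_ ?_
    · exact ((hac j).comp continuous_snd).sub ((hac j).comp continuous_fst)
    · exact (continuous_pi_iff.1 hzc j).comp continuous_snd
  have heq : ∀ ξ ∈ Icc 0 (P.X / ε), ∀ ζ ∈ uIcc 0 ξ, ρ ζ = ζ := by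
    intro ξ hξ ζ hζ
    rw [uIcc_of_le hξ.1] at hζ
    exact hρe ζ ⟨hζ.1, hζ.2.trans hξ.2⟩
  refine ContinuousOn.congr (f := fun ξ => (if m = 1 then 0 else -∫ ζ in (0 : ℝ)..ξ,
      iteratedDeriv i (P.Phi1 (ε * ρ ξ)) (ξ - ζ) * P.ybar' (ε * ρ ζ)) +
      ∫ ζ in (0 : ℝ)..ξ, iteratedDeriv i (P.Phim (ε * ρ ξ)) (ξ - ζ) *
      (∑ j : Fin m, (P.a j (ε * ρ ζ) - P.a j (ε * ρ ξ)) * z (ρ ζ) j + P.f ε (ρ ζ))) ?_ ?_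
  · refine Continuous.continuousOn (Continuous.add ?_ h2)
    split_ifs
    · exact continuous_const
    · exact h1.neg
  · intro ξ hξ
    simp only [opA, hρe ξ hξ]
    congr 1
    · split_ifs
      · rfl
      · congr 1
        exact intervalIntegral.integral_congr fun ζ hζ => by simp only [heq ξ hξ ζ hζ]
    · exact intervalIntegral.integral_congr fun ζ hζ => by simp only [heq ξ hξ ζ hζ]

/-- The terms with ȳ' and f cancel in the difference. The factor ε(ξ-ζ) from the coefficients,
integrated against the kernel, produces β. -/
theorem abs_opA_sub_le (hε : 0 < ε) (hX : 0 < P.X) (hχ : 0 < P.chi)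
    (ha : ∀ j, ContDiffOn ℝ 1 (P.a j) (Icc 0 P.X)) (hyb : ContinuousOn P.ybar' (Icc 0 P.X))
    {CΦ : ℝ} (hC : P.IsPhiBound CΦ) {z w : ℝ → Fin m → ℝ}
    (hz : ContinuousOn z (Icc 0 (P.X / ε))) (hw : ContinuousOn w (Icc 0 (P.X / ε))) {D : ℝ}
    (hD : ∀ ζ ∈ Icc 0 (P.X / ε), ∀ j, |z ζ j - w ζ j| ≤ D) {ξ : ℝ} (hξ : ξ ∈ Icc 0 (P.X / ε))
    (i : Fin m) : |P.opA ε z ξ i - P.opA ε w ξ i| ≤ CΦ * P.beta * ε * D := by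
  have hm : 0 < m := Nat.pos_of_ne_zero (NeZero.ne m)
  have hsub : uIcc 0 ξ ⊆ Icc 0 (P.X / ε) := by
    rw [uIcc_of_le hξ.1]; exact Icc_subset_Icc le_rfl hξ.2
  have hD0 : 0 ≤ D := (abs_nonneg _).trans (hD ξ hξ i)
  have hα := P.alpha_nonneg
  have hint : ∀ v : ℝ → Fin m → ℝ, ContinuousOn v (Icc 0 (P.X / ε)) → IntervalIntegrable
      (fun ζ => iteratedDeriv i (P.Phim (ε * ξ)) (ξ - ζ) *
        (∑ j : Fin m, (P.a j (ε * ζ) - P.a j (ε * ξ)) * v ζ j + P.f ε ζ)) volume 0 ξ := by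
    intro v hv
    exact ((continuous_iteratedDeriv_Phim _ ξ i).continuousOn.mul
      ((continuousOn_opA_integrand hε (fun j => (ha j).continuousOn) hyb hv _).mono
        hsub)).intervalIntegrable
  have hdiff : P.opA ε z ξ i - P.opA ε w ξ i = ∫ ζ in (0 : ℝ)..ξ,
      iteratedDeriv i (P.Phim (ε * ξ)) (ξ - ζ) *
        ∑ j : Fin m, (P.a j (ε * ζ) - P.a j (ε * ξ)) * (z ζ j - w ζ j) := by
    simp only [opA]
    rw [add_sub_add_left_eq_sub, ← intervalIntegral.integral_sub (hint z hz) (hint w hw)]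
    congr 1
    funext ζ
    simp only [mul_sub, Finset.sum_sub_distrib]
    ring
  have hbound : ‖∫ ζ in (0 : ℝ)..ξ, iteratedDeriv i (P.Phim (ε * ξ)) (ξ - ζ) *
        ∑ j : Fin m, (P.a j (ε * ζ) - P.a j (ε * ξ)) * (z ζ j - w ζ j)‖
      ≤ ∫ ζ in (0 : ℝ)..ξ, CΦ * P.alpha * ε * D *
        ((ξ - ζ) * ((1 + (ξ - ζ) ^ (m - 1)) * Real.exp (-P.chi * (ξ - ζ)))) := by
    refine intervalIntegral.norm_integral_le_of_norm_le hξ.1 ?_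
      (Continuous.intervalIntegrable (by fun_prop) _ _)
    refine Eventually.of_forall fun ζ hζ => ?_
    have hζ' : ζ ∈ Icc 0 (P.X / ε) := ⟨hζ.1.le, hζ.2.trans hξ.2⟩
    have hs : 0 ≤ ξ - ζ := sub_nonneg.2 hζ.2
    have h1 := (hC.2 i (ξ - ζ) hs (ε * ξ) (mul_mem_Icc hε hξ)).2
    have h2 := sum_abs_coeff_sub_mul_le hX ha (mul_mem_Icc hε hζ') (mul_mem_Icc hε hξ) (hD ζ hζ')
    have he : |ε * ζ - ε * ξ| = ε * (ξ - ζ) := by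
      rw [← mul_sub, abs_mul, abs_of_pos hε, abs_sub_comm, abs_of_nonneg hs]
    rw [he] at h2
    rw [norm_mul]
    have hCp := hC.1
    calc _ ≤ (CΦ * (1 + (ξ - ζ) ^ (m - 1)) * Real.exp (-P.chi * (ξ - ζ)))
          * (P.alpha * (ε * (ξ - ζ)) * D) :=
          mul_le_mul h1 h2 (abs_nonneg _) (by positivity)
      _ = _ := by ring
  rw [hdiff]
  refine hbound.trans ?_
  rw [intervalIntegral.integral_const_mul]
  have hk := integral_mul_kernel_le hχ hξ.1 hm
  have hCp := hC.1
  calc _ ≤ CΦ * P.alpha * ε * D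
        * ((P.chi ^ (m - 1) + m.factorial) / P.chi ^ (m + 1)) := by gcongr
    _ = _ := by rw [beta]; ring

theorem abs_integral_kernel_mul_le {χ C M ξ : ℝ} (hχ : 0 < χ) (hC : 0 ≤ C) (hM : 0 ≤ M)
    (hξ : 0 ≤ ξ) {k g : ℝ → ℝ}
    (hk : ∀ t, 0 ≤ t → |k t| ≤ C * (1 + t ^ (m - 1)) * Real.exp (-χ * t))
    (hg : ∀ ζ ∈ Ioc 0 ξ, |g ζ| ≤ M) :
    |∫ ζ in (0 : ℝ)..ξ, k (ξ - ζ) * g ζ| ≤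
      C * (M * (χ ^ (m - 1) + (m - 1).factorial) / χ ^ m) := by
  have hm : 0 < m := Nat.pos_of_ne_zero (NeZero.ne m)
  have hbound : ‖∫ ζ in (0 : ℝ)..ξ, k (ξ - ζ) * g ζ‖
      ≤ ∫ ζ in (0 : ℝ)..ξ, C * M * ((1 + (ξ - ζ) ^ (m - 1)) * Real.exp (-χ * (ξ - ζ))) := by
    refine intervalIntegral.norm_integral_le_of_norm_le hξ ?_
      (Continuous.intervalIntegrable (by fun_prop) _ _)
    refine Eventually.of_forall fun ζ hζ => ?_
    have hs : 0 ≤ ξ - ζ := sub_nonneg.2 hζ.2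
    rw [norm_mul]
    calc _ ≤ (C * (1 + (ξ - ζ) ^ (m - 1)) * Real.exp (-χ * (ξ - ζ))) * M :=
          mul_le_mul (hk _ hs) (hg ζ hζ) (abs_nonneg _) (by positivity)
      _ = _ := by ring
  refine hbound.trans ?_
  rw [intervalIntegral.integral_const_mul]
  calc _ ≤ C * M * ((χ ^ (m - 1) + (m - 1).factorial) / χ ^ m) := by
        have := integral_kernel_le hχ hξ hm
        gcongr
    _ = _ := by ring

theorem abs_opA_zero_le (hε : 0 < ε) (hX : 0 < P.X) (hχ : 0 < P.chi)
    (ha : ∀ j, ContDiffOn ℝ 1 (P.a j) (Icc 0 P.X)) (hyb : ContinuousOn P.ybar' (Icc 0 P.X))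
    {CΦ Ct : ℝ} (hC : P.IsPhiBound CΦ) (hCt : P.IsBdryBound Ct) {ξ : ℝ}
    (hξ : ξ ∈ Icc 0 (P.X / ε)) (i : Fin m) :
    |P.opA ε (fun _ _ => 0) ξ i| ≤ CΦ * P.gam Ct := by
  set N := Ct * P.alpha * sSup ((fun ζ : ℝ => (ζ + ζ ^ m) * Real.exp (-P.chi * ζ)) '' Ioi 0)
    with hN
  have hN0 : 0 ≤ N := mul_nonneg (mul_nonneg hCt.nonneg P.alpha_nonneg) P.sSup_layer_nonneg
  have hY0 := supNorm_nonneg P.X P.ybar'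
  have hgam : P.gam Ct = (N + supNorm P.X P.ybar')
    * (P.chi ^ (m - 1) + ((m - 1).factorial : ℝ)) / P.chi ^ m := rfl
  have hx := mul_mem_Icc hε hξ
  have hmem : ∀ ζ ∈ Ioc 0 ξ, ζ ∈ Icc 0 (P.X / ε) := fun ζ hζ => ⟨hζ.1.le, hζ.2.trans hξ.2⟩
  have hlay : ∀ ζ ∈ Ioc 0 ξ, |P.layerSource ε ζ| ≤ N := fun ζ hζ =>
    abs_layerSource_le hε hX hχ ha hCt (hmem ζ hζ) hζ.1
  have hYb : ∀ ζ ∈ Ioc 0 ξ, |P.ybar' (ε * ζ)| ≤ supNorm P.X P.ybar' := fun ζ hζ =>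
    abs_le_supNorm hyb (mul_mem_Icc hε (hmem ζ hζ))
  simp only [opA, mul_zero, Finset.sum_const_zero, zero_add]
  by_cases hm : m = 1
  · simp only [if_pos hm, zero_add, hgam]
    refine abs_integral_kernel_mul_le hχ hC.1.le (add_nonneg hN0 hY0) hξ.1
      (fun t ht => (hC.2 i t ht _ hx).2) fun ζ hζ => ?_
    rw [f_of_eq_one hm]
    exact (abs_sub _ _).trans (add_le_add (hlay ζ hζ) (hYb ζ hζ))
  · simp only [if_neg hm, f_of_ne_one hm]
    have h1 := abs_integral_kernel_mul_le hχ hC.1.le hY0 hξ.1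
      (fun t ht => (hC.2 i t ht _ hx).1) hYb
    have h2 := abs_integral_kernel_mul_le hχ hC.1.le hN0 hξ.1
      (fun t ht => (hC.2 i t ht _ hx).2) hlay
    refine (abs_add_le _ _).trans ?_
    rw [abs_neg]
    refine (add_le_add h1 h2).trans (le_of_eq ?_)
    rw [hgam]
    ring

/-! ### Convergence of the iterates -/

theorem continuousOn_zIter (hε : 0 < ε) (hX : 0 < P.X)
    (ha : ∀ j, ContinuousOn (P.a j) (Icc 0 P.X)) (hyb : ContinuousOn P.ybar' (Icc 0 P.X)) (n : ℕ) :
    ContinuousOn (P.zIter ε n) (Icc 0 (P.X / ε)) := by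
  induction n with
  | zero => exact continuousOn_const
  | succ n ih => exact continuousOn_opA hε hX ha hyb ih

theorem abs_remainder_sub_zIter_le (hε : 0 < ε) (hX : 0 < P.X) (hχ : 0 < P.chi)
    (ha : ∀ j, ContDiffOn ℝ 1 (P.a j) (Icc 0 P.X))
    (hyb : ContDiffOn ℝ 1 P.ybar (Icc 0 P.X))
    (hRH : ∀ x ∈ Icc 0 P.X, RouthHurwitz (P.coeff x)) {y : ℝ → ℝ}
    (hy : P.IsClassicalSolution ε y) {γ₀ CΦ Ct : ℝ} (hγ : γ₀ < 1) (hC : P.IsPhiBound CΦ)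
    (hCt : P.IsBdryBound Ct) (hq : CΦ * P.beta * ε ≤ γ₀) (n : ℕ) :
    ∀ ξ ∈ Icc 0 (P.X / ε), ∀ i, |P.remainder ε y ξ i - P.zIter ε n ξ i|
      ≤ P.C0 γ₀ CΦ Ct * (CΦ * P.beta * ε) ^ n := by
  have hac := fun j => (ha j).continuousOn
  have hyb' := continuousOn_ybar' hX hyb
  have hzc := continuousOn_remainder hε hX hyb.continuousOn hy
  have hfix : ∀ ξ ∈ Icc 0 (P.X / ε), ∀ i,
      P.remainder ε y ξ i = P.opA ε (P.remainder ε y) ξ i := fun ξ hξ i =>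
    remainder_eq_opA hε hX hac hyb hRH hy hξ i
  induction n with
  | zero =>
    have hT : 0 ≤ P.X / ε := by positivity
    obtain ⟨ξ₀, hξ₀, hmax⟩ := isCompact_Icc.exists_isMaxOn (nonempty_Icc.2 hT) hzc.norm
    have hle : ∀ ξ ∈ Icc 0 (P.X / ε), ∀ i, |P.remainder ε y ξ i| ≤ ‖P.remainder ε y ξ₀‖ :=
      fun ξ hξ i => (norm_le_pi_norm (P.remainder ε y ξ) i).trans (hmax hξ)
    have hg := mul_nonneg hC.1.le (P.gam_nonneg hχ hCt.nonneg)
    have hβ := P.beta_nonneg hχ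
    have hCp := hC.1
    -- The fixed-point equation at the point ξ₀ where the norm is maximal, split as (Â[z] - Â[0]) +
    -- Â[0]. As C_Φβε ≤ γ₀ < 1, the first part is absorbed on the left.
    have hD : ‖P.remainder ε y ξ₀‖
        ≤ CΦ * P.beta * ε * ‖P.remainder ε y ξ₀‖ + CΦ * P.gam Ct := by
      refine (pi_norm_le_iff_of_nonneg (by positivity)).2 fun i => ?_
      have h1 := abs_opA_sub_le hε hX hχ ha hyb' hC hzc
        (continuousOn_const : ContinuousOn (fun (_ : ℝ) (_ : Fin m) => (0 : ℝ)) _)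
        (D := ‖P.remainder ε y ξ₀‖) (fun ζ hζ j => by simpa using hle ζ hζ j) hξ₀ i
      have h2 := abs_opA_zero_le hε hX hχ ha hyb' hC hCt hξ₀ i
      rw [hfix ξ₀ hξ₀ i, Real.norm_eq_abs]
      have h3 := abs_add_le (P.opA ε (P.remainder ε y) ξ₀ i - P.opA ε (fun _ _ => 0) ξ₀ i)
        (P.opA ε (fun _ _ => 0) ξ₀ i)
      rw [sub_add_cancel] at h3
      linarith
    have hD2 : ‖P.remainder ε y ξ₀‖ ≤ P.C0 γ₀ CΦ Ct := by
      rw [C0, le_div_iff₀ (by linarith)]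
      nlinarith [norm_nonneg (P.remainder ε y ξ₀)]
    intro ξ hξ i
    simpa [zIter] using (hle ξ hξ i).trans hD2
  | succ n ih =>
    intro ξ hξ i
    rw [hfix ξ hξ i, zIter]
    refine (abs_opA_sub_le hε hX hχ ha hyb' hC hzc (continuousOn_zIter hε hX hac hyb' n)
      ih hξ i).trans (le_of_eq ?_)
    ring

theorem iteratedDerivWithin_sub_yIter (hε : 0 < ε) (y : ℝ → ℝ) (n : ℕ) (i : Fin m) (x : ℝ) :
    iteratedDerivWithin i y (Icc 0 P.X) x - P.yIter ε n i x
      = ε ^ (1 - (i : ℤ)) * (P.remainder ε y (x / ε) i - P.zIter ε n (x / ε) i) := by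
  have hpow : ε ^ (1 - (i : ℤ)) = ε * (ε ^ (i : ℕ))⁻¹ := by
    rw [zpow_sub₀ hε.ne', zpow_one, zpow_natCast, div_eq_mul_inv]
  have hpow' : ε ^ (-(i : ℤ)) = (ε ^ (i : ℕ))⁻¹ := by
    rw [zpow_neg, zpow_natCast]
  simp only [yIter, remainder, scaled, mul_div_cancel₀ x hε.ne']
  by_cases hi : i = 0
  · subst hi
    simp
    field_simp
    ring
  · simp only [if_neg hi, hpow, hpow', sub_zero]
    field_simp
    ring

theorem continuousOn_yIter (hε : 0 < ε) (hX : 0 < P.X)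
    (ha : ∀ j, ContinuousOn (P.a j) (Icc 0 P.X)) (hyb : ContDiffOn ℝ 1 P.ybar (Icc 0 P.X))
    (n : ℕ) (i : Fin m) : ContinuousOn (P.yIter ε n i) (Icc 0 P.X) := by
  have hz : ∀ j, ContinuousOn (fun x => P.zIter ε n (x / ε) j) (Icc 0 P.X) := fun j =>
    (continuousOn_pi.1 (continuousOn_zIter hε hX ha (continuousOn_ybar' hX hyb) n) j).comp
      (by fun_prop) fun x hx => div_mem_Icc hε hx
  have hbd : ∀ j : Fin m, Continuous fun x => iteratedDeriv j P.bdry (x / ε) := fun j =>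
    (continuous_iteratedDeriv_bdry j).comp (by fun_prop)
  unfold yIter
  split_ifs
  · refine (hyb.continuousOn.add ?_).add (continuousOn_const.mul (hz 0))
    simpa using (hbd 0).continuousOn
  · exact (continuousOn_const.mul (hbd i).continuousOn).add (continuousOn_const.mul (hz i))

theorem C0_nonneg (hχ : 0 < P.chi) {γ₀ CΦ Ct : ℝ} (hγ : γ₀ < 1) (hC : P.IsPhiBound CΦ)
    (hCt : P.IsBdryBound Ct) : 0 ≤ P.C0 γ₀ CΦ Ct :=
  div_nonneg (mul_nonneg hC.1.le (P.gam_nonneg hχ hCt.nonneg)) (by linarith)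

end Problem

/-- For i ≥ 2 the factor ε^{1-i} blows up as ε → 0. Once n > i, the power (Bε)^n compensates for it
and leaves a bound independent of ε. For B = 0 the quotient γ₀/B is 0 by convention, which is
harmless because the left side is 0. -/
theorem zpow_mul_mul_pow_le {B ε γ₀ : ℝ} (hB : 0 ≤ B) (hε : 0 < ε) (hγ : 0 < γ₀) (h : B * ε ≤ γ₀)
    {i n : ℕ} (hn : i < n) : ε ^ (1 - (i : ℤ)) * (B * ε) ^ n ≤ γ₀ / B * B ^ i * γ₀ ^ (n - i) := by
  rcases hB.eq_or_lt with rfl | hB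
  · simp [show n ≠ 0 by omega]
  have hpow : ε ^ (1 - (i : ℤ)) = ε * (ε ^ i)⁻¹ := by
    rw [zpow_sub₀ hε.ne', zpow_one, zpow_natCast, div_eq_mul_inv]
  obtain ⟨k, rfl⟩ := Nat.exists_eq_add_of_lt hn
  have hle : ε ≤ γ₀ / B := by rwa [le_div_iff₀' hB]
  calc _ = ε * B ^ i * (B * ε) ^ (k + 1) := by
        rw [hpow, add_assoc, pow_add (B * ε), mul_pow B ε i]
        field_simp
    _ ≤ γ₀ / B * B ^ i * γ₀ ^ (k + 1) := by gcongr
    _ = _ := by rw [show i + k + 1 - i = k + 1 by omega]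

end SingPert

end

/-! ### Proof of the claim -/

theorem mainTheorem1 {m : ℕ} [NeZero m] (P : Problem m) (hX : 0 < P.X)
    (ha : ∀ j, ContDiffOn ℝ 1 (P.a j) (Icc 0 P.X))
    (hb : ContDiffOn ℝ 1 P.b (Icc 0 P.X))
    (hRH : ∀ x ∈ Icc 0 P.X, RouthHurwitz (P.coeff x)) :
    0 < P.chi ∧ (∃ CΦ, P.IsPhiBound CΦ) ∧ (∃ Ct, P.IsBdryBound Ct) ∧
    ∃ y : ℝ → ℝ → ℝ,
      -- `y ε` is the unique classical solution for the parameter `ε`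
      (∀ ε > 0, P.IsClassicalSolution ε (y ε) ∧
        ∀ w, P.IsClassicalSolution ε w → EqOn w (y ε) (Icc 0 P.X)) ∧
      ∀ γ₀ ∈ Ioo (0 : ℝ) 1, ∀ CΦ, P.IsPhiBound CΦ → ∀ Ct, P.IsBdryBound Ct →
        0 < P.eps0 γ₀ CΦ ∧ 0 ≤ P.C0 γ₀ CΦ Ct ∧
        -- the iterates are continuous and satisfy the error estimate
        (∀ ε : ℝ, 0 < ε → ENNReal.ofReal ε ≤ P.eps0 γ₀ CΦ → ∀ (n : ℕ) (i : Fin m),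
          ContinuousOn (P.yIter ε n i) (Icc 0 P.X) ∧
          ∀ x ∈ Icc 0 P.X,
            |iteratedDerivWithin i (y ε) (Icc 0 P.X) x - P.yIter ε n i x| ≤
              P.C0 γ₀ CΦ Ct * ε ^ (1 - (i : ℤ)) * P.rate γ₀ CΦ ε ^ n) ∧
        -- convergence as `n → ∞`, uniform in `x ∈ [0,X]` and `ε ∈ (0,ε₀]`
        (∀ i : Fin m, TendstoUniformlyOn
          (fun (n : ℕ) (p : ℝ × ℝ) => P.yIter p.1 n i p.2)
          (fun p : ℝ × ℝ => iteratedDerivWithin i (y p.1) (Icc 0 P.X) p.2) atTop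
          {p : ℝ × ℝ | 0 < p.1 ∧ ENNReal.ofReal p.1 ≤ P.eps0 γ₀ CΦ ∧ p.2 ∈ Icc 0 P.X}) ∧
        -- asymptotic order in `ε` for each fixed `n`
        (∀ (n : ℕ) (i : Fin m), ∃ K : ℝ, ∀ ε : ℝ, 0 < ε →
          ENNReal.ofReal ε ≤ P.eps0 γ₀ CΦ → ∀ x ∈ Icc 0 P.X,
            |iteratedDerivWithin i (y ε) (Icc 0 P.X) x - P.yIter ε n i x| ≤
              K * ε ^ ((n : ℤ) + 1 - (i : ℤ))) := by
  have hac := fun j => (ha j).continuousOn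
  have hyb := Problem.contDiffOn_ybar ha hb hRH
  have hχ := (P.chi_pos_and_re_le hX hac hRH).1
  refine ⟨hχ, P.exists_isPhiBound hX hac hRH, P.exists_isBdryBound hX hac hRH, ?_⟩
  have hex : ∀ ε : ℝ, ∃ y : ℝ → ℝ, 0 < ε → P.IsClassicalSolution ε y := by
    intro ε
    by_cases hε : 0 < ε
    · obtain ⟨y, hy⟩ := P.exists_isClassicalSolution hε hX hac hb.continuousOn
      exact ⟨y, fun _ => hy⟩
    · exact ⟨0, fun h => absurd h hε⟩
  choose y hy using hex
  refine ⟨y, fun ε hε => ⟨hy ε hε, fun w hw => (hy ε hε).eqOn hε hX hac hb.continuousOn hw⟩, ?_⟩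
  intro γ₀ hγ CΦ hC Ct hCt
  have hC0 := Problem.C0_nonneg hχ hγ.2 hC hCt
  have hB : 0 ≤ CΦ * P.beta := mul_nonneg hC.1.le (Problem.beta_nonneg hχ)
  have herr : ∀ ε : ℝ, 0 < ε → ENNReal.ofReal ε ≤ P.eps0 γ₀ CΦ → ∀ (n : ℕ) (i : Fin m),
      ∀ x ∈ Icc 0 P.X, |iteratedDerivWithin i (y ε) (Icc 0 P.X) x - P.yIter ε n i x|
        ≤ P.C0 γ₀ CΦ Ct * ε ^ (1 - (i : ℤ)) * (CΦ * P.beta * ε) ^ n := by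
    intro ε hε hle n i x hx
    have h := Problem.abs_remainder_sub_zIter_le hε hX hχ ha hyb hRH (hy ε hε) hγ.2 hC hCt
      (Problem.le_of_le_eps0 hχ hγ.1 hC.1 hle) n (x / ε) (Problem.div_mem_Icc hε hx) i
    have hp : 0 < ε ^ (1 - (i : ℤ)) := zpow_pos hε _
    rw [Problem.iteratedDerivWithin_sub_yIter hε, abs_mul, abs_of_pos hp]
    calc _ ≤ ε ^ (1 - (i : ℤ)) * (P.C0 γ₀ CΦ Ct * (CΦ * P.beta * ε) ^ n) := by gcongr
      _ = _ := by ring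
  refine ⟨Problem.eps0_pos hγ.1, hC0, ?_, ?_, ?_⟩
  · intro ε hε hle n i
    refine ⟨Problem.continuousOn_yIter hε hX hac hyb n i, fun x hx => ?_⟩
    rw [Problem.rate_eq hχ hγ.1 hC.1 hε]
    exact herr ε hε hle n i x hx
  · intro i
    rw [Metric.tendstoUniformlyOn_iff]
    intro δ hδ
    -- A majorant independent of ε and x. It is valid only for n > i, which suffices for the limit.
    have hlim : Tendsto (fun n : ℕ => P.C0 γ₀ CΦ Ct *
        (γ₀ / (CΦ * P.beta) * (CΦ * P.beta) ^ (i : ℕ) * γ₀ ^ (n - (i : ℕ)))) atTop (𝓝 0) := by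
      have h := (tendsto_pow_atTop_nhds_zero_of_lt_one hγ.1.le hγ.2).comp
        (tendsto_sub_atTop_nat (i : ℕ))
      simpa using (h.const_mul (γ₀ / (CΦ * P.beta) * (CΦ * P.beta) ^ (i : ℕ))).const_mul
        (P.C0 γ₀ CΦ Ct)
    filter_upwards [hlim.eventually_lt_const hδ, eventually_gt_atTop (i : ℕ)] with n hn hin p hp
    rw [Real.dist_eq]
    refine (herr p.1 hp.1 hp.2.1 n i p.2 hp.2.2).trans_lt (lt_of_le_of_lt ?_ hn)
    rw [mul_assoc]
    exact mul_le_mul_of_nonneg_left (zpow_mul_mul_pow_le hB hp.1 hγ.1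
      (Problem.le_of_le_eps0 hχ hγ.1 hC.1 hp.2.1) hin) hC0
  · intro n i
    refine ⟨P.C0 γ₀ CΦ Ct * (CΦ * P.beta) ^ n, fun ε hε hle x hx => ?_⟩
    refine (herr ε hε hle n i x hx).trans (le_of_eq ?_)
    have : ε ^ ((n : ℤ) + 1 - (i : ℤ)) = ε ^ (1 - (i : ℤ)) * ε ^ n := by
      rw [← zpow_natCast ε n, ← zpow_add₀ hε.ne']
      congr 1
      ring
    rw [this, mul_pow]
    ring
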